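/- There is an absolute constant $C>0$ such that the following holds for every dimension $p$. Let $f\colon\mathbb R^p\to\mathbb R$ be three times continuously differentiable with a global maximum at $x^*$, and suppose that $D_G^2:=-\nabla^2 f(x^*)$ is positive definite. Let $G$ be a real $p\times p$ matrix, write $G^2=G^\top G$, and suppose that $\ell(y):=f(y)+\|G(y-x^*)\|^2/2$ is concave on $\mathbb R^p$. Put $$D:=(D_G^2-G^2)^{1/2},\qquad p_G:=\operatorname{tr}(D^2D_G^{-2}),\qquad r_G:=2\sqrt{p_G}+\sqrt{2\mathrm x},\qquad U:=\{u\in\mathbb R^p:\ \|Du\|\le \nu^{-1}r_G\},$$ where $\mathrm x>0$ and $0<\nu\le 3/4$ (for instance $\nu=2/3$). For $n>0$ let $h:=-\ell/n$, and suppose that for some $c_3\ge 0$ $$\bigl|\langle\nabla^3h(x^*+tu),u^{\otimes3}\rangle\bigr|\le c_3\,\langle\nabla^2h(x^*),u^{\otimes2}\rangle^{3/2}\qquad\text{for all }u\in U,\ t\in[0,1],$$ that $c_3\,r_G\,n^{-1/2}\le 3/4$, and that $\omega\,p_G\le 2/3$ for some $\omega$ such that $$\bigl|f(x^*+u)-f(x^*)-\langle\nabla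 f(x^*),u\rangle-\tfrac12\langle\nabla^2f(x^*),u^{\otimes2}\rangle\bigr|\le \tfrac{\omega}{2}\|Du\|^2\qquad\text{for all }u\in U.$$ Then $e^{f}$ is integrable, the probability measure $\mathbb P_f$ with density proportional to $e^{f}$ has a finite first moment, and its mean $\bar x:=\int x\,\mathbb P_f(dx)$ satisfies, for every $q$ and every linear map $Q\colon\mathbb R^p\to\mathbb R^q$, $$\|Q(\bar x-x^*)\|\le 2.4\,c_3\,(p_G+1)^{3/2}\,n^{-1/2}\,\|QD_G^{-2}Q^\top\|^{1/2}+C\,\|QD_G^{-2}Q^\top\|^{1/2}\,e^{-\mathrm x}.$$ In particular, for $Q=D$, $$\|D(\bar x-x^*)\|\le 2.4\,c_3\,(p_G+1)^{3/2}\,n^{-1/2}\,\|DD_G^{-2}D\|^{1/2}+C\,e^{-\mathrm x} \qquad\text{and}\qquad \|D(\bar x-x^*)\|\le 2.4\,c_3\,(p_G+1)^{3/2}\,n^{-1/2}+C\,e^{-\mathrm x}.$$ Norms of vectors are Euclidean and norms of matrices are the corresponding operator norms. -/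

import Mathlib

open MeasureTheory
open scoped Matrix MatrixOrder

noncomputable section

/-- The posterior `P_f` on `ℝᵖ`, with density proportional to `exp f`. -/
def posterior {p : ℕ} (f : EuclideanSpace ℝ (Fin p) → ℝ) :
    Measure (EuclideanSpace ℝ (Fin p)) :=
  ((volume.withDensity fun x => ENNReal.ofReal (Real.exp (f x))) Set.univ)⁻¹ •
    volume.withDensity fun x => ENNReal.ofReal (Real.exp (f x))

/-- The posterior mean. -/
def posteriorMean {p : ℕ} (f : EuclideanSpace ℝ (Fin p) → ℝ) : EuclideanSpace ℝ (Fin p) :=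
  ∫ x, x ∂(posterior f)

/-- The negative Hessian matrix `-∇²f(x)`; at the maximiser `x*` of `f` this is `D_G²`. -/
def negHessian {p : ℕ} (f : EuclideanSpace ℝ (Fin p) → ℝ) (x : EuclideanSpace ℝ (Fin p)) :
    Matrix (Fin p) (Fin p) ℝ :=
  Matrix.of fun i j =>
    -iteratedFDeriv ℝ 2 f x ![EuclideanSpace.single i 1, EuclideanSpace.single j 1]

/-- The function `ℓ(x) = f(x) + ‖G (x - x*)‖² / 2`, that is, `f` without its quadratic penalty. -/
def unpenalized {p : ℕ} (f : EuclideanSpace ℝ (Fin p) → ℝ) (G : Matrix (Fin p) (Fin p) ℝ)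
    (xs x : EuclideanSpace ℝ (Fin p)) : ℝ :=
  f x + ‖Matrix.toEuclideanLin G (x - xs)‖ ^ 2 / 2

/-- The matrix `D = (D_G² - G²)^{1/2}`, where `G²` stands for `Gᵀ G`; so `D² = -∇²ℓ(x*)`. -/
def matD {p : ℕ} (f : EuclideanSpace ℝ (Fin p) → ℝ) (G : Matrix (Fin p) (Fin p) ℝ)
    (xs : EuclideanSpace ℝ (Fin p)) : Matrix (Fin p) (Fin p) ℝ :=
  CFC.sqrt (negHessian f xs - Gᵀ * G)

/-- The effective dimension `p_G = tr (D² D_G⁻²)`. -/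
def effDim {p : ℕ} (f : EuclideanSpace ℝ (Fin p) → ℝ) (G : Matrix (Fin p) (Fin p) ℝ)
    (xs : EuclideanSpace ℝ (Fin p)) : ℝ :=
  ((negHessian f xs - Gᵀ * G) * (negHessian f xs)⁻¹).trace

/-- The radius `r_G = 2 √p_G + √(2 x)`. -/
def radius {p : ℕ} (f : EuclideanSpace ℝ (Fin p) → ℝ) (G : Matrix (Fin p) (Fin p) ℝ)
    (xs : EuclideanSpace ℝ (Fin p)) (x : ℝ) : ℝ :=
  2 * √(effDim f G xs) + √(2 * x)

/-- The local set `U = {u : ‖D u‖ ≤ ν⁻¹ r_G}`. -/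
def localSet {p : ℕ} (f : EuclideanSpace ℝ (Fin p) → ℝ) (G : Matrix (Fin p) (Fin p) ℝ)
    (xs : EuclideanSpace ℝ (Fin p)) (ν x : ℝ) : Set (EuclideanSpace ℝ (Fin p)) :=
  {u | ‖Matrix.toEuclideanLin (matD f G xs) u‖ ≤ ν⁻¹ * radius f G xs x}

/-- The remainder `δ₃(x, u)` of the second order Taylor expansion of `f` at `x`. -/
def taylorRemainder {p : ℕ} (f : EuclideanSpace ℝ (Fin p) → ℝ)
    (x u : EuclideanSpace ℝ (Fin p)) : ℝ :=
  f (x + u) - f x - fderiv ℝ f x u - iteratedFDeriv ℝ 2 f x (fun _ => u) / 2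

/-- With `h` given by `-ℓ = n h`: for all `u ∈ U` and `t ∈ [0, 1]`,
`|⟨∇³h(x* + t u), u^{⊗3}⟩| ≤ c₃ ⟨∇²h(x*), u^{⊗2}⟩^{3/2}`. -/
def SelfConcordant {p : ℕ} (f : EuclideanSpace ℝ (Fin p) → ℝ) (G : Matrix (Fin p) (Fin p) ℝ)
    (xs : EuclideanSpace ℝ (Fin p)) (ν x n c₃ : ℝ) : Prop :=
  let h : EuclideanSpace ℝ (Fin p) → ℝ := fun y => -unpenalized f G xs y / n
  ∀ u ∈ localSet f G xs ν x, ∀ t ∈ Set.Icc (0 : ℝ) 1,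
    |iteratedFDeriv ℝ 3 h (xs + t • u) (fun _ => u)| ≤
      c₃ * (iteratedFDeriv ℝ 2 h xs (fun _ => u)) ^ (3 / 2 : ℝ)

/-- `‖Q D_G⁻² Qᵀ‖`, the operator norm for the Euclidean norm. -/
def projVar {p q : ℕ} (f : EuclideanSpace ℝ (Fin p) → ℝ) (xs : EuclideanSpace ℝ (Fin p))
    (Q : Matrix (Fin q) (Fin p) ℝ) : ℝ :=
  ‖Matrix.toEuclideanCLM (𝕜 := ℝ) (Q * (negHessian f xs)⁻¹ * Qᵀ)‖

end

/-! ### Integrals against Gaussians with diagonal precision. -/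

section GaussianIntegrals

open Real

/-! Choose coordinates `x = x* + A ξ` in which `D_G²` is the identity and `D²` is `diag l`, with `0
≤ lᵢ ≤ 1` and `P = ∑ lᵢ = p_G` (`exists_simultaneous_diagonalization`). Let `F = f - f(x*)` in this
chart, `S = ∑ lᵢ ξᵢ² = ‖Du‖²`, `τ = c₃ n^{-1/2}` and `R = 4 r_G / 3`. As `ν ≤ 3/4`, the bulk `S ≤
R²` lies in `U`.

On the bulk the error `F + |ξ|²/2` is at most `τ S^{3/2} / 6`, and also at most `v S / 2` for some
`v` with `v P ≤ 2/3`. A linear functional is odd and the bulk is symmetric, so the Gaussian part of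
its first moment vanishes. The rest is bounded by the integral of `|z·ξ| τ S^{3/2} / 6` against the
Gaussian with precisions `1 - v lᵢ` (`integral_abs_linear_mul_sqrt_pow_three_le`). By
`gaussMass_le_rpow_mul` its mass is at most `3/2` of the standard one: the dimension enters only
through `P`.

Off the bulk, concavity of `ℓ` makes `F + |ξ|²/2 - S/2` decay at least like `-R √S / 3`. The
quadratic `S/2 - |ξ|²/2` may be degenerate, so on dyadic-type shells a part of the linear decay is
traded for a small positive precision `κ`. This costs a factor `κ^{-(P+1)/2}`, which the remaining
decay absorbs because `R² ≥ 16/9 (4P + 2x)`; a factor `e^{-x}` is left (`lintegral_tail_le`).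

The normalizing constant is bounded below through `e^t ≥ 1 + t`, and `diagonal_laplace_mean`
combines the estimates for scalar functionals. Testing with the vector `Q(x̄ - x*)` itself then
gives the norm bound (`norm_toEuclideanLin_posteriorMean_sub_le`). -/

theorem integrable_exp_linear_sub_sq {c : ℝ} (hc : 0 < c) (z : ℝ) :
    Integrable fun t : ℝ => exp (z * t - c * t ^ 2 / 2) := by
  have h := ((integrable_exp_neg_mul_sq (half_pos hc)).comp_sub_right (z / c)).const_mul
    (exp (z ^ 2 / (2 * c)))
  refine h.congr (.of_forall fun t => ?_)
  simp only [← exp_add]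
  congr 1
  field_simp
  ring

theorem integral_exp_linear_sub_sq {c : ℝ} (hc : 0 < c) (z : ℝ) :
    ∫ t : ℝ, exp (z * t - c * t ^ 2 / 2) = √(2 * π / c) * exp (z ^ 2 / (2 * c)) := by
  have h : (fun t : ℝ => exp (z * t - c * t ^ 2 / 2)) = fun t =>
      exp (z ^ 2 / (2 * c)) * (fun s => exp (-(c / 2) * s ^ 2)) (t - z / c) := by
    ext t
    simp only [← exp_add]
    congr 1
    field_simp
    ring
  rw [h, integral_const_mul, integral_sub_right_eq_self (fun s => exp (-(c / 2) * s ^ 2)),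
    integral_gaussian, mul_comm]
  congr 2
  field_simp

theorem integrable_pow_mul_exp_neg_sq {c : ℝ} (hc : 0 < c) (k : ℕ) :
    Integrable fun t : ℝ => t ^ k * exp (-(c * t ^ 2 / 2)) := by
  have h := integrable_rpow_mul_exp_neg_mul_sq (half_pos hc) (s := k)
    (by have : (0 : ℝ) ≤ k := k.cast_nonneg
        linarith)
  refine h.congr (.of_forall fun t => ?_)
  simp only [rpow_natCast]
  congr 2
  ring

/-- Integration by parts against the antiderivative of `t e^{-ct²/2}`. Iterating it from `k = 0`
produces the sixth-moment constant `15 = 5·3·1`. -/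
theorem integral_pow_add_two_mul_exp_neg_sq {c : ℝ} (hc : 0 < c) (k : ℕ) :
    ∫ t : ℝ, t ^ (k + 2) * exp (-(c * t ^ 2 / 2)) =
      (k + 1) / c * ∫ t : ℝ, t ^ k * exp (-(c * t ^ 2 / 2)) := by
  have hv : ∀ t : ℝ, HasDerivAt (fun t => -(1 / c) * exp (-(c * t ^ 2 / 2)))
      (t * exp (-(c * t ^ 2 / 2))) t := by
    intro t
    have h := (((((hasDerivAt_pow 2 t).const_mul c).div_const 2).neg).exp).const_mul (-(1 / c))
    convert! h using 1
    simp
    field_simp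
  have hu : ∀ t : ℝ, HasDerivAt (fun t : ℝ => t ^ (k + 1)) ((k + 1 : ℝ) * t ^ k) t := by
    intro t
    simpa using hasDerivAt_pow (k + 1) t
  have h := integral_mul_deriv_eq_deriv_mul_of_integrable (fun t _ => hu t) (fun t _ => hv t) ?_ ?_ ?_
  · rw [← integral_const_mul]
    have e1 : ∀ t : ℝ, t ^ (k + 2) * exp (-(c * t ^ 2 / 2)) =
        t ^ (k + 1) * (t * exp (-(c * t ^ 2 / 2))) := fun t => by ring
    simp_rw [e1]
    rw [h, ← integral_neg]
    congr 1
    ext t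
    field_simp
  · refine (integrable_pow_mul_exp_neg_sq hc (k + 2)).congr (.of_forall fun t => ?_)
    simp only [Pi.mul_apply]
    ring
  · refine ((integrable_pow_mul_exp_neg_sq hc k).const_mul (-(k + 1) / c)).congr
      (.of_forall fun t => ?_)
    simp only [Pi.mul_apply]
    field_simp
  · refine ((integrable_pow_mul_exp_neg_sq hc (k + 1)).const_mul (-1 / c)).congr
      (.of_forall fun t => ?_)
    simp only [Pi.mul_apply]
    field_simp

theorem integral_exp_neg_sq {c : ℝ} (hc : 0 < c) :
    ∫ t : ℝ, exp (-(c * t ^ 2 / 2)) = √(2 * π / c) := by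
  simpa using integral_exp_linear_sub_sq hc 0

theorem integral_sq_mul_exp_neg_sq {c : ℝ} (hc : 0 < c) :
    ∫ t : ℝ, t ^ 2 * exp (-(c * t ^ 2 / 2)) = 1 / c * √(2 * π / c) := by
  simpa [integral_exp_neg_sq hc] using integral_pow_add_two_mul_exp_neg_sq hc 0

theorem integral_pow_six_mul_exp_neg_sq {c : ℝ} (hc : 0 < c) :
    ∫ t : ℝ, t ^ 6 * exp (-(c * t ^ 2 / 2)) = 15 / c ^ 3 * √(2 * π / c) := by
  have h4 := integral_pow_add_two_mul_exp_neg_sq hc 2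
  have h6 := integral_pow_add_two_mul_exp_neg_sq hc 4
  norm_num at h4 h6
  rw [h6, h4, integral_sq_mul_exp_neg_sq hc]
  field_simp
  norm_num

variable {ι : Type*} [Fintype ι]

/-- The unnormalized centred Gaussian density on `ι → ℝ` with diagonal precision `c`. -/
noncomputable def gaussWeight (c : ι → ℝ) (ξ : ι → ℝ) : ℝ := exp (-(∑ i, c i * ξ i ^ 2) / 2)

/-- The total mass of `gaussWeight c`. -/
noncomputable def gaussMass (c : ι → ℝ) : ℝ := ∏ i, √(2 * π / c i)

theorem gaussWeight_pos (c ξ : ι → ℝ) : 0 < gaussWeight c ξ := exp_pos _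

theorem gaussMass_pos {c : ι → ℝ} (hc : ∀ i, 0 < c i) : 0 < gaussMass c :=
  Finset.prod_pos fun i _ => sqrt_pos.2 (div_pos (by positivity) (hc i))

@[fun_prop]
theorem continuous_gaussWeight (c : ι → ℝ) : Continuous (gaussWeight c) := by
  unfold gaussWeight
  fun_prop

theorem exp_linear_mul_gaussWeight (c z ξ : ι → ℝ) :
    exp (∑ i, z i * ξ i) * gaussWeight c ξ = ∏ i, exp (z i * ξ i - c i * ξ i ^ 2 / 2) := by
  rw [gaussWeight, ← exp_add, ← exp_sum]
  congr 1
  rw [Finset.sum_sub_distrib, ← Finset.sum_div]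
  ring

theorem integrable_exp_linear_mul_gaussWeight {c : ι → ℝ} (hc : ∀ i, 0 < c i) (z : ι → ℝ) :
    Integrable fun ξ : ι → ℝ => exp (∑ i, z i * ξ i) * gaussWeight c ξ := by
  simp_rw [exp_linear_mul_gaussWeight]
  exact Integrable.fintype_prod (f := fun i t => exp (z i * t - c i * t ^ 2 / 2))
    fun i => integrable_exp_linear_sub_sq (hc i) (z i)

theorem integral_exp_linear_mul_gaussWeight {c : ι → ℝ} (hc : ∀ i, 0 < c i) (z : ι → ℝ) :
    ∫ ξ : ι → ℝ, exp (∑ i, z i * ξ i) * gaussWeight c ξ =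
      gaussMass c * exp (∑ i, z i ^ 2 / (2 * c i)) := by
  simp_rw [exp_linear_mul_gaussWeight]
  rw [integral_fintype_prod_volume_eq_prod (f := fun i t => exp (z i * t - c i * t ^ 2 / 2)),
    gaussMass, exp_sum, ← Finset.prod_mul_distrib]
  exact Finset.prod_congr rfl fun i _ => integral_exp_linear_sub_sq (hc i) (z i)

theorem integrable_gaussWeight {c : ι → ℝ} (hc : ∀ i, 0 < c i) : Integrable (gaussWeight c) := by
  simpa using integrable_exp_linear_mul_gaussWeight hc 0

theorem integral_gaussWeight {c : ι → ℝ} (hc : ∀ i, 0 < c i) :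
    ∫ ξ, gaussWeight c ξ = gaussMass c := by
  simpa using integral_exp_linear_mul_gaussWeight hc 0

theorem pow_mul_gaussWeight [DecidableEq ι] (c ξ : ι → ℝ) (i : ι) (k : ℕ) :
    ξ i ^ k * gaussWeight c ξ =
      ∏ j, (if j = i then ξ j ^ k else 1) * exp (-(c j * ξ j ^ 2 / 2)) := by
  rw [Finset.prod_mul_distrib, Finset.prod_ite_eq' Finset.univ i, if_pos (Finset.mem_univ _),
    ← exp_sum, gaussWeight, Finset.sum_neg_distrib, ← Finset.sum_div, neg_div]

theorem integrable_pow_mul_gaussWeight {c : ι → ℝ} (hc : ∀ i, 0 < c i) (i : ι) (k : ℕ) :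
    Integrable fun ξ : ι → ℝ => ξ i ^ k * gaussWeight c ξ := by
  classical
  simp_rw [pow_mul_gaussWeight]
  refine Integrable.fintype_prod
    (f := fun j t => (if j = i then t ^ k else 1) * exp (-(c j * t ^ 2 / 2))) fun j => ?_
  by_cases h : j = i
  · simpa [h] using integrable_pow_mul_exp_neg_sq (hc i) k
  · simpa [h] using integrable_pow_mul_exp_neg_sq (hc j) 0

theorem integral_pow_mul_gaussWeight {c : ι → ℝ} (hc : ∀ i, 0 < c i) (i : ι) (k : ℕ) {m : ℝ}
    (hm : ∫ t : ℝ, t ^ k * exp (-(c i * t ^ 2 / 2)) = m * √(2 * π / c i)) :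
    ∫ ξ : ι → ℝ, ξ i ^ k * gaussWeight c ξ = m * gaussMass c := by
  classical
  simp_rw [pow_mul_gaussWeight]
  rw [integral_fintype_prod_volume_eq_prod
    (f := fun j t => (if j = i then t ^ k else 1) * exp (-(c j * t ^ 2 / 2)))]
  have h : ∀ j, ∫ t : ℝ, (if j = i then t ^ k else 1) * exp (-(c j * t ^ 2 / 2)) =
      (if j = i then m else 1) * √(2 * π / c j) := by
    intro j
    by_cases h : j = i
    · subst h
      simpa using hm
    · simpa [h] using integral_exp_neg_sq (hc j)
  simp_rw [h]
  rw [Finset.prod_mul_distrib, Finset.prod_ite_eq' Finset.univ i, if_pos (Finset.mem_univ _),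
    gaussMass]

end GaussianIntegrals

/-! ### Dimension-free bounds for Gaussian mass and moments. -/

section GaussianEstimates

open Real

variable {ι : Type*} [Fintype ι]

/-- Bernoulli's inequality for exponents in `[0, 1]`. -/
theorem rpow_le_one_sub_one_sub_mul {k t : ℝ} (hk : 0 < k) (ht0 : 0 ≤ t) (ht1 : t ≤ 1) :
    k ^ t ≤ 1 - (1 - k) * t := by
  have h := rpow_one_add_le_one_add_mul_self (s := k - 1) (by linarith) ht0 ht1
  rw [add_sub_cancel] at h
  linarith

/-- Bernoulli gives `k^{lᵢ} ≤ 1 - (1 - k) lᵢ` in each coordinate, and the product of the left sides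
depends on `l` only through its sum. This is how the effective dimension replaces `p`. -/
theorem gaussMass_le_rpow_mul {k : ℝ} (hk : 0 < k) {l : ι → ℝ} (h0 : ∀ i, 0 ≤ l i)
    (h1 : ∀ i, l i ≤ 1) :
    gaussMass (fun i => 1 - (1 - k) * l i) ≤ k ^ (-(∑ i, l i) / 2) * gaussMass (1 : ι → ℝ) := by
  have hp : k ^ (-(∑ i, l i) / 2) = ∏ i, k ^ (-(l i) / 2) := by
    rw [← Real.rpow_sum_of_pos hk, ← Finset.sum_div, Finset.sum_neg_distrib]
  rw [hp, gaussMass, gaussMass, ← Finset.prod_mul_distrib]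
  refine Finset.prod_le_prod (fun i _ => sqrt_nonneg _) fun i _ => ?_
  have hb := rpow_le_one_sub_one_sub_mul hk (h0 i) (h1 i)
  have hkp : 0 < k ^ l i := rpow_pos_of_pos hk _
  have hs : k ^ (-(l i) / 2) = √((k ^ l i)⁻¹) := by
    rw [← rpow_neg hk.le, sqrt_eq_rpow, ← rpow_mul hk.le]
    congr 1
    ring
  rw [hs, ← sqrt_mul (inv_nonneg.2 hkp.le)]
  refine sqrt_le_sqrt ?_
  rw [Pi.one_apply, div_one, div_eq_mul_inv, mul_comm]
  gcongr

theorem abs_le_inv_mul_exp_add_exp {θ : ℝ} (hθ : 0 < θ) (y : ℝ) :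
    |y| ≤ θ⁻¹ * (exp (θ * y) + exp (-θ * y)) := by
  rw [← div_eq_inv_mul, le_div_iff₀ hθ]
  have h1 := add_one_le_exp (θ * y)
  have h2 := add_one_le_exp (-θ * y)
  have h3 := exp_pos (θ * y)
  have h4 := exp_pos (-θ * y)
  rcases abs_cases y with ⟨h, _⟩ | ⟨h, _⟩ <;> rw [h] <;> linarith

/-- The bracket is `4 sinh²(θy/2)`, and `|sinh t| ≥ |t|`. Moments of linear forms thus reduce to the
explicit exponential integrals. -/
theorem sq_le_inv_sq_mul_exp_add_exp {θ : ℝ} (hθ : 0 < θ) (y : ℝ) :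
    y ^ 2 ≤ (θ ^ 2)⁻¹ * (exp (θ * y) + exp (-θ * y) - 2) := by
  have h : ∀ t : ℝ, t ^ 2 ≤ sinh t ^ 2 := fun t => by
    rw [sq_le_sq]
    rcases le_total 0 t with ht | ht
    · rw [abs_of_nonneg ht, abs_of_nonneg (sinh_nonneg_iff.2 ht)]
      exact self_le_sinh_iff.2 ht
    · rw [abs_of_nonpos ht, abs_of_nonpos (sinh_nonpos_iff.2 ht)]
      exact neg_le_neg (sinh_le_self_iff.2 ht)
  have h1 := h (θ * y / 2)
  have h2 : exp (θ * y) + exp (-θ * y) - 2 = 4 * sinh (θ * y / 2) ^ 2 := by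
    rw [sinh_eq, show θ * y = θ * y / 2 + θ * y / 2 by ring,
      show -θ * y = -(θ * y / 2) + -(θ * y / 2) by ring, exp_add, exp_add]
    have h3 : exp (θ * y / 2) * exp (-(θ * y / 2)) = 1 := by rw [← exp_add]; simp
    ring_nf at h3 ⊢
    linarith
  rw [← div_eq_inv_mul, le_div_iff₀ (by positivity), h2]
  linarith [h1]

theorem integral_exp_smul_linear_mul_gaussWeight_le {c : ι → ℝ} {m : ℝ} (hm : 0 < m)
    (hc : ∀ i, m ≤ c i) (z : ι → ℝ) (θ : ℝ) :
    ∫ ξ : ι → ℝ, exp (θ * ∑ i, z i * ξ i) * gaussWeight c ξ ≤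
      gaussMass c * exp (θ ^ 2 * (∑ i, z i ^ 2) / (2 * m)) := by
  have hc0 : ∀ i, 0 < c i := fun i => hm.trans_le (hc i)
  have h := integral_exp_linear_mul_gaussWeight hc0 (fun i => θ * z i)
  simp_rw [mul_assoc, ← Finset.mul_sum] at h
  rw [h]
  refine mul_le_mul_of_nonneg_left (exp_le_exp.2 ?_) (gaussMass_pos hc0).le
  rw [Finset.mul_sum, Finset.sum_div]
  refine Finset.sum_le_sum fun i _ => ?_
  rw [mul_pow]
  have := hc i
  gcongr

theorem integrable_exp_smul_linear_mul_gaussWeight {c : ι → ℝ} (hc : ∀ i, 0 < c i) (z : ι → ℝ)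
    (θ : ℝ) : Integrable fun ξ : ι → ℝ => exp (θ * ∑ i, z i * ξ i) * gaussWeight c ξ := by
  have h := integrable_exp_linear_mul_gaussWeight hc (fun i => θ * z i)
  simpa only [mul_assoc, ← Finset.mul_sum] using h

theorem integrable_abs_linear_mul_gaussWeight {c : ι → ℝ} (hc : ∀ i, 0 < c i) (z : ι → ℝ) :
    Integrable fun ξ : ι → ℝ => |∑ i, z i * ξ i| * gaussWeight c ξ := by
  have h := (integrable_exp_smul_linear_mul_gaussWeight hc z 1).add
    (integrable_exp_smul_linear_mul_gaussWeight hc z (-1))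
  refine h.mono' (by fun_prop) (.of_forall fun ξ => ?_)
  have hw := gaussWeight_pos c ξ
  rw [norm_of_nonneg (by positivity), Pi.add_apply, ← add_mul]
  gcongr
  simpa using abs_le_inv_mul_exp_add_exp one_pos (∑ i, z i * ξ i)

theorem integrable_sq_linear_mul_gaussWeight {c : ι → ℝ} (hc : ∀ i, 0 < c i) (z : ι → ℝ) :
    Integrable fun ξ : ι → ℝ => (∑ i, z i * ξ i) ^ 2 * gaussWeight c ξ := by
  have h := (integrable_exp_smul_linear_mul_gaussWeight hc z 1).add
    (integrable_exp_smul_linear_mul_gaussWeight hc z (-1))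
  refine h.mono' (by fun_prop) (.of_forall fun ξ => ?_)
  have hw := gaussWeight_pos c ξ
  rw [norm_of_nonneg (by positivity), Pi.add_apply, ← add_mul]
  gcongr
  have := sq_le_inv_sq_mul_exp_add_exp one_pos (∑ i, z i * ξ i)
  simp only [one_pow, inv_one, one_mul] at this ⊢
  linarith

theorem eq_zero_of_sum_sq_eq_zero {z : ι → ℝ} (h : ∑ i, z i ^ 2 = 0) (i : ι) : z i = 0 := by
  have := (Finset.sum_eq_zero_iff_of_nonneg fun i _ => sq_nonneg (z i)).1 h i (Finset.mem_univ i)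
  exact pow_eq_zero_iff two_ne_zero |>.1 this

theorem integral_abs_linear_mul_gaussWeight_le {c : ι → ℝ} {m : ℝ} (hm : 0 < m)
    (hc : ∀ i, m ≤ c i) (z : ι → ℝ) :
    ∫ ξ : ι → ℝ, |∑ i, z i * ξ i| * gaussWeight c ξ ≤
      2 * exp (1 / 2) * √(∑ i, z i ^ 2) * (√m)⁻¹ * gaussMass c := by
  have hc0 : ∀ i, 0 < c i := fun i => hm.trans_le (hc i)
  rcases (Finset.sum_nonneg fun i (_ : i ∈ Finset.univ) => sq_nonneg (z i)).eq_or_lt with h | h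
  · simp [eq_zero_of_sum_sq_eq_zero h.symm]
  set σ := √(∑ i, z i ^ 2) with hσ
  have hσ0 : 0 < σ := sqrt_pos.2 h
  have hσ2 : ∑ i, z i ^ 2 = σ ^ 2 := (sq_sqrt h.le).symm
  have hm0 : 0 < √m := sqrt_pos.2 hm
  have hm2 : m = √m ^ 2 := (sq_sqrt hm.le).symm
  -- With `θ = √m / σ` the Gaussian exponent `θ² σ² / (2m)` equals `1/2`.
  have hθ : 0 < √m / σ := div_pos hm0 hσ0
  have hM := gaussMass_pos hc0
  have key : ∀ θ : ℝ, θ ^ 2 = (√m / σ) ^ 2 →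
      ∫ ξ : ι → ℝ, exp (θ * ∑ i, z i * ξ i) * gaussWeight c ξ ≤ gaussMass c * exp (1 / 2) := by
    intro θ h
    refine (integral_exp_smul_linear_mul_gaussWeight_le hm hc z θ).trans_eq ?_
    rw [h, hσ2, div_pow, ← hm2]
    congr 2
    field_simp
  calc _ ≤ ∫ ξ : ι → ℝ, ((√m / σ)⁻¹ * (exp (√m / σ * ∑ i, z i * ξ i) * gaussWeight c ξ) +
        (√m / σ)⁻¹ * (exp (-(√m / σ) * ∑ i, z i * ξ i) * gaussWeight c ξ)) := by
        refine integral_mono (integrable_abs_linear_mul_gaussWeight hc0 z)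
          (((integrable_exp_smul_linear_mul_gaussWeight hc0 z _).const_mul _).add
          ((integrable_exp_smul_linear_mul_gaussWeight hc0 z _).const_mul _)) fun ξ => ?_
        have := mul_le_mul_of_nonneg_right (abs_le_inv_mul_exp_add_exp hθ (∑ i, z i * ξ i))
          (gaussWeight_pos c ξ).le
        simp only
        linarith
    _ ≤ (√m / σ)⁻¹ * (gaussMass c * exp (1 / 2)) + (√m / σ)⁻¹ * (gaussMass c * exp (1 / 2)) := by
        rw [integral_add ((integrable_exp_smul_linear_mul_gaussWeight hc0 z _).const_mul _)
          ((integrable_exp_smul_linear_mul_gaussWeight hc0 z _).const_mul _), integral_const_mul,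
          integral_const_mul]
        gcongr
        · exact key _ rfl
        · exact key _ (neg_sq _)
    _ = _ := by
        rw [inv_div]
        field_simp
        ring

theorem integral_sq_linear_mul_gaussWeight_le {c : ι → ℝ} {m : ℝ} (hm : 0 < m)
    (hc : ∀ i, m ≤ c i) (z : ι → ℝ) :
    ∫ ξ : ι → ℝ, (∑ i, z i * ξ i) ^ 2 * gaussWeight c ξ ≤
      10 / 9 * (∑ i, z i ^ 2) / m * gaussMass c := by
  have hc0 : ∀ i, 0 < c i := fun i => hm.trans_le (hc i)
  rcases (Finset.sum_nonneg fun i (_ : i ∈ Finset.univ) => sq_nonneg (z i)).eq_or_lt with h | h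
  · simp [eq_zero_of_sum_sq_eq_zero h.symm]
  set V := ∑ i, z i ^ 2 with hV
  have hM := gaussMass_pos hc0
  -- This makes the exponent `1/10`; from `e^{1/10} ≤ 10/9` the bound `2 (10/9 - 1) / θ²` is exactly
  -- `10/9 · V / m`.
  set θ := √(m / (5 * V)) with hθd
  have hθ : 0 < θ := sqrt_pos.2 (by positivity)
  have hθ2 : θ ^ 2 = m / (5 * V) := sq_sqrt (by positivity)
  have hexp : exp (1 / 10) ≤ 10 / 9 := by
    have h1 := one_sub_le_exp_neg (1 / 10)
    rw [exp_neg] at h1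
    have h2 := exp_pos (1 / 10)
    rw [le_inv_comm₀ (by norm_num) h2] at h1
    linarith
  have key : ∀ t : ℝ, t ^ 2 = θ ^ 2 →
      ∫ ξ : ι → ℝ, exp (t * ∑ i, z i * ξ i) * gaussWeight c ξ ≤ gaussMass c * (10 / 9) := by
    intro t h
    refine (integral_exp_smul_linear_mul_gaussWeight_le hm hc z t).trans ?_
    refine mul_le_mul_of_nonneg_left ?_ hM.le
    refine le_of_eq_of_le ?_ hexp
    rw [h, hθ2, ← hV]
    congr 1
    field_simp
    norm_num
  have i1 := fun t => integrable_exp_smul_linear_mul_gaussWeight hc0 z t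
  have i2 : Integrable fun ξ : ι → ℝ => exp (θ * ∑ i, z i * ξ i) * gaussWeight c ξ +
      exp (-θ * ∑ i, z i * ξ i) * gaussWeight c ξ := (i1 _).add (i1 _)
  calc _ ≤ ∫ ξ : ι → ℝ, (θ ^ 2)⁻¹ * ((exp (θ * ∑ i, z i * ξ i) * gaussWeight c ξ +
        exp (-θ * ∑ i, z i * ξ i) * gaussWeight c ξ) - 2 * gaussWeight c ξ) := by
        refine integral_mono (integrable_sq_linear_mul_gaussWeight hc0 z)
          ((i2.sub ((integrable_gaussWeight hc0).const_mul 2)).const_mul _)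
          fun ξ => ?_
        have := mul_le_mul_of_nonneg_right (sq_le_inv_sq_mul_exp_add_exp hθ (∑ i, z i * ξ i))
          (gaussWeight_pos c ξ).le
        simp only
        linarith
    _ ≤ (θ ^ 2)⁻¹ * ((gaussMass c * (10 / 9) + gaussMass c * (10 / 9)) - 2 * gaussMass c) := by
        rw [integral_const_mul, integral_sub i2
          ((integrable_gaussWeight hc0).const_mul 2), integral_add (i1 _) (i1 _),
          integral_const_mul, integral_gaussWeight hc0]
        gcongr
        · exact key _ rfl
        · exact key _ (neg_sq _)
    _ = _ := by
        rw [hθ2]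
        field_simp
        ring

/-- Jensen for `t³` with weights `lᵢ / ∑ l`. It removes the mixed moments, so that only
one-coordinate sixth moments are needed. -/
theorem weighted_sum_sq_pow_three_le {l : ι → ℝ} (h0 : ∀ i, 0 ≤ l i) (ξ : ι → ℝ) :
    (∑ i, l i * ξ i ^ 2) ^ 3 ≤ (∑ i, l i) ^ 2 * ∑ i, l i * ξ i ^ 6 := by
  rcases (Finset.sum_nonneg fun i (_ : i ∈ Finset.univ) => h0 i).eq_or_lt with h | h
  · have h2 := fun i => (Finset.sum_eq_zero_iff_of_nonneg fun i _ => h0 i).1 h.symm i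
      (Finset.mem_univ i)
    simp [h2]
  set P := ∑ i, l i
  have hj := Real.pow_arith_mean_le_arith_mean_pow Finset.univ (fun i => l i / P)
    (fun i => ξ i ^ 2) (fun i _ => div_nonneg (h0 i) h.le)
    (by rw [← Finset.sum_div]; exact div_self h.ne') (fun i _ => sq_nonneg _) 3
  have e1 : ∑ i, l i / P * ξ i ^ 2 = (∑ i, l i * ξ i ^ 2) / P := by
    rw [Finset.sum_div]
    exact Finset.sum_congr rfl fun i _ => by ring
  have e2 : ∑ i, l i / P * (ξ i ^ 2) ^ 3 = (∑ i, l i * ξ i ^ 6) / P := by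
    rw [Finset.sum_div]
    exact Finset.sum_congr rfl fun i _ => by ring
  rw [e1, e2, div_pow, div_le_div_iff₀ (by positivity) h] at hj
  refine le_of_mul_le_mul_right ?_ h
  linarith

theorem integrable_weighted_sum_sq_pow_three_mul_gaussWeight {c : ι → ℝ} (hc : ∀ i, 0 < c i)
    {l : ι → ℝ} (h0 : ∀ i, 0 ≤ l i) :
    Integrable fun ξ : ι → ℝ => (∑ i, l i * ξ i ^ 2) ^ 3 * gaussWeight c ξ := by
  have h : Integrable fun ξ : ι → ℝ =>
      (∑ i, l i) ^ 2 * ∑ i, l i * (ξ i ^ 6 * gaussWeight c ξ) :=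
    (integrable_finsetSum _ fun i _ => (integrable_pow_mul_gaussWeight hc i 6).const_mul _).const_mul _
  refine h.mono' (by fun_prop) (.of_forall fun ξ => ?_)
  have hw := gaussWeight_pos c ξ
  have hs : 0 ≤ ∑ i, l i * ξ i ^ 2 := Finset.sum_nonneg fun i _ => mul_nonneg (h0 i) (sq_nonneg _)
  rw [norm_of_nonneg (by positivity)]
  simp_rw [← mul_assoc, ← Finset.sum_mul]
  rw [← mul_assoc]
  exact mul_le_mul_of_nonneg_right (weighted_sum_sq_pow_three_le h0 ξ) hw.le

theorem integral_weighted_sum_sq_pow_three_mul_gaussWeight_le {c : ι → ℝ} {m : ℝ} (hm : 0 < m)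
    (hc : ∀ i, m ≤ c i) {l : ι → ℝ} (h0 : ∀ i, 0 ≤ l i) :
    ∫ ξ : ι → ℝ, (∑ i, l i * ξ i ^ 2) ^ 3 * gaussWeight c ξ ≤
      15 * (∑ i, l i) ^ 3 / m ^ 3 * gaussMass c := by
  have hc0 : ∀ i, 0 < c i := fun i => hm.trans_le (hc i)
  have hM := gaussMass_pos hc0
  have hi : ∀ i, Integrable fun ξ : ι → ℝ => l i * (ξ i ^ 6 * gaussWeight c ξ) := fun i =>
    (integrable_pow_mul_gaussWeight hc0 i 6).const_mul _
  calc _ ≤ ∫ ξ : ι → ℝ, (∑ i, l i) ^ 2 * ∑ i, l i * (ξ i ^ 6 * gaussWeight c ξ) := by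
        refine integral_mono (integrable_weighted_sum_sq_pow_three_mul_gaussWeight hc0 h0)
          ((integrable_finsetSum _ fun i _ => hi i).const_mul _) fun ξ => ?_
        simp_rw [← mul_assoc, ← Finset.sum_mul]
        rw [← mul_assoc]
        exact mul_le_mul_of_nonneg_right (weighted_sum_sq_pow_three_le h0 ξ)
          (gaussWeight_pos c ξ).le
    _ = (∑ i, l i) ^ 2 * ∑ i, l i * (15 / c i ^ 3 * gaussMass c) := by
        rw [integral_const_mul, integral_finsetSum _ fun i _ => hi i]
        congr 1
        refine Finset.sum_congr rfl fun i _ => ?_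
        rw [integral_const_mul, integral_pow_mul_gaussWeight hc0 i 6
          (integral_pow_six_mul_exp_neg_sq (hc0 i))]
    _ ≤ (∑ i, l i) ^ 2 * ∑ i, l i * (15 / m ^ 3 * gaussMass c) := by
        gcongr with i
        · exact h0 i
        · exact hc i
    _ = _ := by
        rw [← Finset.sum_mul]
        ring

end GaussianEstimates

/-! ### The third-order bulk moment and the tail integral. -/

section BulkAndTail

open Real

variable {ι : Type*} [Fintype ι]

/-- The weighted square norm `∑ lᵢ ξᵢ²`. -/
def weightedSq (l ξ : ι → ℝ) : ℝ := ∑ i, l i * ξ i ^ 2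

@[fun_prop]
theorem continuous_weightedSq (l : ι → ℝ) : Continuous (weightedSq l) := by
  unfold weightedSq
  fun_prop

theorem weightedSq_nonneg {l : ι → ℝ} (h0 : ∀ i, 0 ≤ l i) (ξ : ι → ℝ) : 0 ≤ weightedSq l ξ :=
  Finset.sum_nonneg fun i _ => mul_nonneg (h0 i) (sq_nonneg _)

/-- An error `w S / 2` in the log-density is the same as lowering the precisions by `w lᵢ`. -/
theorem gaussWeight_one_sub (l ξ : ι → ℝ) (w : ℝ) :
    gaussWeight (fun i => 1 - w * l i) ξ = exp (w * weightedSq l ξ / 2 - (∑ i, ξ i ^ 2) / 2) := by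
  rw [gaussWeight, weightedSq]
  congr 1
  simp_rw [sub_mul, one_mul, mul_assoc]
  rw [Finset.sum_sub_distrib, ← Finset.mul_sum]
  ring

theorem gaussMass_one_sub_le {l : ι → ℝ} (h0 : ∀ i, 0 ≤ l i) (h1 : ∀ i, l i ≤ 1) {w : ℝ}
    (hw0 : 0 ≤ w) (hw : w ≤ 1 / 3) (hP : w * ∑ i, l i ≤ 2 / 3) :
    gaussMass (fun i => 1 - w * l i) ≤ 3 / 2 * gaussMass (1 : ι → ℝ) := by
  -- The weights `3 w lᵢ` lie in `[0, 1]` because `w ≤ 1/3`, and `w P ≤ 2/3` keeps the exponent of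
  -- `2/3` at least `-1`.
  have h := gaussMass_le_rpow_mul (k := 2 / 3) (by norm_num) (l := fun i => 3 * w * l i)
    (fun i => by have := h0 i; positivity) (fun i => by nlinarith [h0 i, h1 i])
  have e : (fun i => 1 - (1 - (2 / 3 : ℝ)) * (3 * w * l i)) = fun i => 1 - w * l i := by
    ext i
    ring
  rw [e, ← Finset.mul_sum] at h
  refine h.trans ?_
  have hN := gaussMass_pos (c := (1 : ι → ℝ)) fun _ => one_pos
  refine mul_le_mul_of_nonneg_right ?_ hN.le
  calc (2 / 3 : ℝ) ^ (-(3 * w * ∑ i, l i) / 2) ≤ (2 / 3 : ℝ) ^ (-1 : ℝ) :=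
        rpow_le_rpow_of_exponent_ge (by norm_num) (by norm_num) (by linarith)
    _ = 3 / 2 := by rw [rpow_neg_one]; norm_num

theorem abs_mul_sqrt_pow_three_le {a : ℝ} (ha : 0 < a) (y : ℝ) {s : ℝ} (hs : 0 ≤ s) :
    |y| * √s ^ 3 ≤ a / 2 * y ^ 2 + 1 / (2 * a) * s ^ 3 := by
  have h1 : s ^ 3 = (√s ^ 3) ^ 2 := by
    rw [← pow_mul, mul_comm, pow_mul, sq_sqrt hs]
  rw [h1, ← sq_abs y]
  generalize |y| = u
  generalize √s ^ 3 = v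
  have h2 : a / 2 * u ^ 2 + 1 / (2 * a) * v ^ 2 - u * v = (a * u - v) ^ 2 / (2 * a) := by
    field_simp
    ring
  have h3 : 0 ≤ (a * u - v) ^ 2 / (2 * a) := by positivity
  linarith

theorem integrable_abs_linear_mul_sqrt_pow_three {c : ι → ℝ} (hc : ∀ i, 0 < c i) {l : ι → ℝ}
    (h0 : ∀ i, 0 ≤ l i) (z : ι → ℝ) :
    Integrable fun ξ : ι → ℝ => |∑ i, z i * ξ i| * √(weightedSq l ξ) ^ 3 * gaussWeight c ξ := by
  refine (((integrable_sq_linear_mul_gaussWeight hc z).const_mul (1 / 2)).add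
    ((integrable_weighted_sum_sq_pow_three_mul_gaussWeight hc h0).const_mul (1 / (2 * 1)))).mono'
    (by fun_prop) (.of_forall fun ξ => ?_)
  have hw := gaussWeight_pos c ξ
  rw [norm_of_nonneg (by positivity), Pi.add_apply, ← mul_assoc, ← mul_assoc, ← add_mul]
  exact mul_le_mul_of_nonneg_right
    (abs_mul_sqrt_pow_three_le one_pos _ (weightedSq_nonneg h0 ξ)) hw.le

/-- Young's inequality separates the linear form from `S^{3/2}`. The reduced precision is harmless:
`w ≤ 1/3` handles `(1 - w)⁻¹`, `w (P + 1) ≤ 1` turns `P / (1 - w)` into `P + 1`, and `w P ≤ 2/3`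
controls the mass. -/
theorem integral_abs_linear_mul_sqrt_pow_three_le {l : ι → ℝ} (h0 : ∀ i, 0 ≤ l i)
    (h1 : ∀ i, l i ≤ 1) {w : ℝ} (hw0 : 0 ≤ w) (hw : w ≤ 1 / 3) (hP : w * ∑ i, l i ≤ 2 / 3)
    (hq : w * (∑ i, l i + 1) ≤ 1) (z : ι → ℝ) :
    ∫ ξ : ι → ℝ, |∑ i, z i * ξ i| * √(weightedSq l ξ) ^ 3 * gaussWeight (fun i => 1 - w * l i) ξ ≤
      15 / 2 * √(∑ i, z i ^ 2) * √(∑ i, l i + 1) ^ 3 * gaussMass (1 : ι → ℝ) := by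
  have hm : 0 < 1 - w := by linarith
  have hc : ∀ i, 1 - w ≤ 1 - w * l i := fun i => by nlinarith [h1 i]
  have hc0 : ∀ i, 0 < 1 - w * l i := fun i => hm.trans_le (hc i)
  rcases (Finset.sum_nonneg fun i (_ : i ∈ Finset.univ) => sq_nonneg (z i)).eq_or_lt with h | h
  · simp [eq_zero_of_sum_sq_eq_zero h.symm]
  set σ := √(∑ i, z i ^ 2) with hσ
  have hσ0 : 0 < σ := sqrt_pos.2 h
  have hσ2 : ∑ i, z i ^ 2 = σ ^ 2 := (sq_sqrt h.le).symm
  set P := ∑ i, l i with hPd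
  have hP0 : 0 ≤ P := Finset.sum_nonneg fun i _ => h0 i
  set t := √(P + 1) ^ 3 with ht
  have hs0 : 0 < √(P + 1) := sqrt_pos.2 (by linarith)
  have ht0 : 0 < t := pow_pos hs0 3
  have ht2 : t ^ 2 = (P + 1) ^ 3 := by
    rw [ht, ← pow_mul, mul_comm, pow_mul, sq_sqrt (by linarith)]
  -- This value balances the two terms of Young's inequality: each becomes `5/2 · σ t M`.
  set a := 3 * t / σ with ha
  have ha0 : 0 < a := by positivity
  set M := gaussMass fun i => 1 - w * l i with hMd
  have hM0 : 0 < M := gaussMass_pos hc0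
  have hM : M ≤ 3 / 2 * gaussMass (1 : ι → ℝ) := gaussMass_one_sub_le h0 h1 hw0 hw hP
  have i1 := (integrable_sq_linear_mul_gaussWeight hc0 z).const_mul (a / 2)
  have i2 := (integrable_weighted_sum_sq_pow_three_mul_gaussWeight hc0 h0).const_mul (1 / (2 * a))
  have hmi : (1 - w)⁻¹ ≤ 3 / 2 := by
    rw [inv_le_comm₀ hm (by norm_num)]
    linarith
  have hPm : P / (1 - w) ≤ P + 1 := by
    rw [div_le_iff₀ hm]
    linarith [hq]
  calc _ ≤ ∫ ξ : ι → ℝ, (a / 2 * ((∑ i, z i * ξ i) ^ 2 * gaussWeight (fun i => 1 - w * l i) ξ) +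
        1 / (2 * a) * ((∑ i, l i * ξ i ^ 2) ^ 3 * gaussWeight (fun i => 1 - w * l i) ξ)) := by
        refine integral_mono (integrable_abs_linear_mul_sqrt_pow_three hc0 h0 z) (i1.add i2)
          fun ξ => ?_
        simp only
        rw [← mul_assoc, ← mul_assoc, ← add_mul]
        exact mul_le_mul_of_nonneg_right
          (abs_mul_sqrt_pow_three_le ha0 _ (weightedSq_nonneg h0 ξ)) (gaussWeight_pos _ ξ).le
    _ ≤ a / 2 * (10 / 9 * σ ^ 2 / (1 - w) * M) + 1 / (2 * a) * (15 * P ^ 3 / (1 - w) ^ 3 * M) := by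
        rw [integral_add i1 i2, integral_const_mul, integral_const_mul, ← hσ2]
        gcongr
        · exact integral_sq_linear_mul_gaussWeight_le hm hc z
        · exact integral_weighted_sum_sq_pow_three_mul_gaussWeight_le hm hc h0
    _ = 5 / 3 * σ * t * M * (1 - w)⁻¹ + 5 / 2 * σ / t * M * (P / (1 - w)) ^ 3 := by
        rw [ha]
        field_simp
        ring
    _ ≤ 5 / 3 * σ * t * M * (3 / 2) + 5 / 2 * σ / t * M * (P + 1) ^ 3 := by
        gcongr
    _ = 5 * σ * t * M := by
        rw [← ht2]
        field_simp
        ring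
    _ ≤ 5 * σ * t * (3 / 2 * gaussMass (1 : ι → ℝ)) := by gcongr
    _ = _ := by ring

theorem integral_one_sub_weightedSq_mul_gaussWeight (l : ι → ℝ) (a : ℝ) :
    Integrable (fun ξ : ι → ℝ => (1 - a * weightedSq l ξ) * gaussWeight 1 ξ) ∧
    ∫ ξ : ι → ℝ, (1 - a * weightedSq l ξ) * gaussWeight 1 ξ =
      (1 - a * ∑ i, l i) * gaussMass (1 : ι → ℝ) := by
  have hi : ∀ i, Integrable fun ξ : ι → ℝ => l i * (ξ i ^ 2 * gaussWeight 1 ξ) := fun i =>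
    (integrable_pow_mul_gaussWeight (fun _ => one_pos) i 2).const_mul _
  have e : ∀ ξ : ι → ℝ, (1 - a * weightedSq l ξ) * gaussWeight 1 ξ =
      gaussWeight 1 ξ - a * ∑ i, l i * (ξ i ^ 2 * gaussWeight 1 ξ) := fun ξ => by
    simp_rw [weightedSq, ← mul_assoc, ← Finset.sum_mul]
    ring
  simp_rw [e]
  have i1 := integrable_gaussWeight (c := (1 : ι → ℝ)) fun _ => one_pos
  have i2 : Integrable fun ξ : ι → ℝ => a * ∑ i, l i * (ξ i ^ 2 * gaussWeight 1 ξ) :=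
    (integrable_finsetSum _ fun i _ => hi i).const_mul a
  refine ⟨i1.sub i2, ?_⟩
  rw [integral_sub i1 i2, integral_const_mul, integral_finsetSum _ fun i _ => hi i,
    integral_gaussWeight (c := (1 : ι → ℝ)) fun _ => one_pos]
  have : ∀ i, ∫ ξ : ι → ℝ, l i * (ξ i ^ 2 * gaussWeight 1 ξ) = l i * gaussMass (1 : ι → ℝ) := by
    intro i
    rw [integral_const_mul, integral_pow_mul_gaussWeight (c := (1 : ι → ℝ)) (fun _ => one_pos) i 2
      (integral_sq_mul_exp_neg_sq (by simp))]
    simp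
  simp_rw [this]
  rw [← Finset.sum_mul]
  ring

/-- Here `17/60 · 16/9` slightly exceeds `1/2`, so the decay supplies `e^{-x}` and about `e^{-2P}`
already at `k = 0`. The losses are at most `exp((5/2 + 3k/2)(P + 1)/2)`, since `10 ≤ e^{5/2}` and `4
≤ e^{3/2}`. The bound `P ≥ 1/2` ensures geometric decay in `k`. -/
theorem shell_exponent_le {P x R : ℝ} (hP : 1 / 2 ≤ P) (hx : 0 ≤ x)
    (hR : 16 / 9 * (4 * P + 2 * x) ≤ R ^ 2) (k : ℕ) :
    exp (-(17 / 60) * 4 ^ k * R ^ 2) *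
      ((√(1 / (10 * 4 ^ k)))⁻¹ * (1 / (10 * 4 ^ k) : ℝ) ^ (-P / 2)) ≤
      exp (5 / 4) * exp (-x) * (1 / 2) ^ k := by
  have he : (2.7 : ℝ) ≤ exp 1 := by linarith [exp_one_gt_d9]
  have h10 : (10 : ℝ) ≤ exp (5 / 2) := by
    have h : exp (5 / 2) ^ 2 = exp 1 ^ 5 := by
      rw [← exp_nat_mul, ← exp_nat_mul]
      norm_num
    have h2 : (2.7 : ℝ) ^ 5 ≤ exp 1 ^ 5 := by gcongr
    refine le_of_sq_le_sq ?_ (exp_pos _).le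
    rw [h]
    refine le_trans ?_ h2
    norm_num
  have h4 : (4 : ℝ) ≤ exp (3 / 2) := by
    have h : exp (3 / 2) ^ 2 = exp 1 ^ 3 := by
      rw [← exp_nat_mul, ← exp_nat_mul]
      norm_num
    have h2 : (2.7 : ℝ) ^ 3 ≤ exp 1 ^ 3 := by gcongr
    refine le_of_sq_le_sq ?_ (exp_pos _).le
    rw [h]
    refine le_trans ?_ h2
    norm_num
  have hk4 : (1 : ℝ) + k * 3 ≤ 4 ^ k := by
    have := one_add_mul_le_pow (a := (3 : ℝ)) (by norm_num) k
    norm_num at this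
    exact this
  set κ : ℝ := 1 / (10 * 4 ^ k) with hκ
  have hκ0 : 0 < κ := by positivity
  have hκe : exp (-(5 / 2 + 3 / 2 * k)) ≤ κ := by
    rw [hκ, exp_neg, ← one_div]
    refine one_div_le_one_div_of_le (by positivity) ?_
    rw [exp_add, mul_comm (3 / 2 : ℝ), exp_nat_mul]
    gcongr
  have hrp : ∀ {r : ℝ}, 0 ≤ r → κ ^ (-r) ≤ exp ((5 / 2 + 3 / 2 * k) * r) := by
    intro r hr
    refine (rpow_le_rpow_of_nonpos (exp_pos _) hκe (by linarith)).trans_eq ?_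
    rw [← exp_mul]
    congr 1
    ring
  have hs : (√κ)⁻¹ = κ ^ (-(1 / 2) : ℝ) := by rw [rpow_neg hκ0.le, sqrt_eq_rpow]
  have hk0 : (0 : ℝ) ≤ k := k.cast_nonneg
  calc _ ≤ exp (-(17 / 60) * 4 ^ k * R ^ 2) *
        (exp ((5 / 2 + 3 / 2 * k) * (1 / 2)) * exp ((5 / 2 + 3 / 2 * k) * (P / 2))) := by
        rw [hs, neg_div]
        gcongr
        · exact hrp (by norm_num)
        · exact hrp (by linarith)
    _ ≤ exp (5 / 4) * exp (-x) * exp (-1) ^ k := by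
        rw [← exp_add, ← exp_add, ← exp_add, ← exp_nat_mul, ← exp_add]
        refine exp_le_exp.2 ?_
        have h1 : (1 + k * 3) * (16 / 9 * (4 * P + 2 * x)) ≤ 4 ^ k * R ^ 2 := by gcongr
        nlinarith [mul_nonneg hk0 hx, mul_nonneg hk0 (sub_nonneg.2 hP)]
    _ ≤ _ := by
        have : exp (-1) ≤ 1 / 2 := by
          rw [exp_neg, ← one_div]
          exact one_div_le_one_div_of_le (by norm_num) (by linarith)
        gcongr

/-- The weight `V` is abstract so that one argument serves both the total mass and the first
moments. Working with the lower integral yields integrability along with the bound. -/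
theorem lintegral_tail_le {l : ι → ℝ} (h0 : ∀ i, 0 ≤ l i) (h1 : ∀ i, l i ≤ 1) {x R : ℝ}
    (hx : 0 ≤ x) (hR0 : 0 < R) (hR : 16 / 9 * (4 * ∑ i, l i + 2 * x) ≤ R ^ 2)
    {V F : (ι → ℝ) → ℝ} (hVm : Measurable V) (hV0 : ∀ ξ, 0 ≤ V ξ) {B : ℝ} (hB : 0 ≤ B)
    (hV : ∀ (c : ι → ℝ) (k : ℝ), 0 < k → k ≤ 1 → (∀ i, k ≤ c i) →
      Integrable (fun ξ => V ξ * gaussWeight c ξ) ∧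
        ∫ ξ, V ξ * gaussWeight c ξ ≤ B * (√k)⁻¹ * gaussMass c)
    (hF : ∀ ξ, R ^ 2 < weightedSq l ξ →
      F ξ ≤ -(R * √(weightedSq l ξ) / 3) + weightedSq l ξ / 2 - (∑ i, ξ i ^ 2) / 2) :
    ∫⁻ ξ in {ξ | R ^ 2 < weightedSq l ξ}, ENNReal.ofReal (V ξ * exp (F ξ)) ≤
      ENNReal.ofReal (2 * exp (5 / 4) * B * exp (-x) * gaussMass (1 : ι → ℝ)) := by
  set P := ∑ i, l i with hPd
  have hP0 : 0 ≤ P := Finset.sum_nonneg fun i _ => h0 i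
  have hN := gaussMass_pos (c := (1 : ι → ℝ)) fun _ => one_pos
  set N := gaussMass (1 : ι → ℝ) with hNd
  have hmV : ∀ (a : ℝ) (c : ι → ℝ),
      Measurable fun ξ => ENNReal.ofReal (a * (V ξ * gaussWeight c ξ)) := fun a c =>
    ((hVm.mul (continuous_gaussWeight c).measurable).const_mul a).ennreal_ofReal
  have hlint : ∀ (a : ℝ) (c : ι → ℝ) (k : ℝ), 0 ≤ a → 0 < k → k ≤ 1 → (∀ i, k ≤ c i) →
      ∫⁻ ξ, ENNReal.ofReal (a * (V ξ * gaussWeight c ξ)) ≤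
        ENNReal.ofReal (a * (B * (√k)⁻¹ * gaussMass c)) := by
    intro a c k ha hk hk1 hc
    obtain ⟨hi, hle⟩ := hV c k hk hk1 hc
    rw [← ofReal_integral_eq_lintegral_ofReal (hi.const_mul a)
      (.of_forall fun ξ => mul_nonneg ha (mul_nonneg (hV0 ξ) (gaussWeight_pos c ξ).le)),
      integral_const_mul]
    gcongr
  -- For `P ≤ 1/2` every `lᵢ ≤ 1/2`, so the precisions `1 - lᵢ` are already nondegenerate and no
  -- shells are needed.
  rcases le_or_gt P (1 / 2) with hP | hP
  · have hl : ∀ i, l i ≤ 1 / 2 := fun i =>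
      (Finset.single_le_sum (fun j _ => h0 j) (Finset.mem_univ i)).trans hP
    have hmass : gaussMass (fun i => 1 - 1 * l i) ≤ 2 * N := by
      have h := gaussMass_le_rpow_mul (k := 1 / 2) (by norm_num) (l := fun i => 2 * l i)
        (fun i => by have := h0 i; positivity) (fun i => by linarith [hl i])
      have e : (fun i => 1 - (1 - (1 / 2 : ℝ)) * (2 * l i)) = fun i => 1 - 1 * l i := by
        ext i
        ring
      rw [e, ← Finset.mul_sum] at h
      refine h.trans (mul_le_mul_of_nonneg_right ?_ hN.le)
      calc (1 / 2 : ℝ) ^ (-(2 * P) / 2) ≤ (1 / 2 : ℝ) ^ (-1 : ℝ) :=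
            rpow_le_rpow_of_exponent_ge (by norm_num) (by norm_num) (by linarith)
        _ = 2 := by rw [rpow_neg_one]; norm_num
    have hM0 : 0 ≤ gaussMass (fun i => 1 - 1 * l i) :=
      (gaussMass_pos fun i => by linarith [hl i]).le
    have hs2 : (√(1 / 2 : ℝ))⁻¹ ≤ 2 := by
      rw [inv_le_comm₀ (by positivity) (by norm_num)]
      exact le_sqrt_of_sq_le (by norm_num)
    have he2 : 2 ≤ exp (5 / 4) := by linarith [add_one_le_exp (5 / 4 : ℝ)]
    calc _ ≤ ∫⁻ ξ in {ξ | R ^ 2 < weightedSq l ξ}, ENNReal.ofReal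
          (exp (-x) * (V ξ * gaussWeight (fun i => 1 - 1 * l i) ξ)) := by
          refine setLIntegral_mono (hmV _ _) fun ξ hξ => ENNReal.ofReal_le_ofReal ?_
          rw [mul_left_comm]
          refine mul_le_mul_of_nonneg_left ?_ (hV0 ξ)
          rw [gaussWeight_one_sub, ← exp_add]
          refine exp_le_exp.2 ((hF ξ hξ).trans ?_)
          have h2 : R * R ≤ R * √(weightedSq l ξ) :=
            mul_le_mul_of_nonneg_left (le_sqrt_of_sq_le (le_of_lt hξ)) hR0.le
          nlinarith
      _ ≤ ∫⁻ ξ, ENNReal.ofReal (exp (-x) * (V ξ * gaussWeight (fun i => 1 - 1 * l i) ξ)) :=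
          setLIntegral_le_lintegral _ _
      _ ≤ ENNReal.ofReal
          (exp (-x) * (B * (√(1 / 2))⁻¹ * gaussMass fun i => 1 - 1 * l i)) :=
          hlint _ _ _ (exp_pos _).le (by norm_num) (by norm_num) fun i => by linarith [hl i]
      _ ≤ _ := by
          refine ENNReal.ofReal_le_ofReal ?_
          calc _ ≤ exp (-x) * (B * 2 * (2 * N)) := by gcongr
            _ = 2 * 2 * B * exp (-x) * N := by ring
            _ ≤ _ := by gcongr
  -- `κ k` is the precision restored on the shell `4^k R ≤ √S < 4^{k+1} R`; it must shrink like
  -- `4^{-k}` for `κ S / 2` to stay below the linear gain `R √S / 3`.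
  · set κ : ℕ → ℝ := fun k => 1 / (10 * 4 ^ k) with hκ
    have hκ0 : ∀ k, 0 < κ k := fun k => by positivity
    have hκ1 : ∀ k, κ k ≤ 1 := fun k => by
      have : (1 : ℝ) ≤ 4 ^ k := one_le_pow₀ (by norm_num)
      rw [hκ, div_le_one (by positivity)]
      linarith
    set c : ℕ → ι → ℝ := fun k i => 1 - (1 - κ k) * l i with hc
    have hcκ : ∀ k i, κ k ≤ c k i := fun k i => by
      have := mul_nonneg (sub_nonneg.2 (hκ1 k)) (sub_nonneg.2 (h1 i))
      simp only [hc]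
      linarith
    set a : ℕ → ℝ := fun k => exp (-(17 / 60) * 4 ^ k * R ^ 2) with ha
    have hshell : ∀ ξ, R ^ 2 < weightedSq l ξ →
        ∃ k, V ξ * exp (F ξ) ≤ a k * (V ξ * gaussWeight (c k) ξ) := by
      intro ξ hξ
      set s := √(weightedSq l ξ) with hs
      have hs2 : weightedSq l ξ = s ^ 2 := (sq_sqrt (weightedSq_nonneg h0 ξ)).symm
      have hRs : R ≤ s := le_sqrt_of_sq_le hξ.le
      obtain ⟨k, hk1, hk2⟩ := exists_nat_pow_near (x := s / R) (y := 4)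
        ((one_le_div hR0).2 hRs) (by norm_num)
      rw [le_div_iff₀ hR0] at hk1
      rw [div_lt_iff₀ hR0, pow_succ] at hk2
      refine ⟨k, ?_⟩
      rw [mul_left_comm]
      refine mul_le_mul_of_nonneg_left ?_ (hV0 ξ)
      rw [hc, gaussWeight_one_sub, ha, ← exp_add]
      refine exp_le_exp.2 ((hF ξ hξ).trans ?_)
      rw [hs2, sqrt_sq (sqrt_nonneg _)]
      have h4 : (0 : ℝ) < 4 ^ k := by positivity
      -- The constant `17/60` makes the quadratic in `s` vanish at the inner radius `4^k R`; its
      -- other root `17/3 · 4^k R` lies beyond the shell.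
      have h3 : (s - 4 ^ k * R) * (3 * s - 17 * (4 ^ k * R)) / (60 * 4 ^ k) ≤ 0 := by
        refine div_nonpos_of_nonpos_of_nonneg ?_ (by positivity)
        refine mul_nonpos_of_nonneg_of_nonpos (by linarith) ?_
        have : 0 < 4 ^ k * R := by positivity
        linarith
      have h5 : (s - 4 ^ k * R) * (3 * s - 17 * (4 ^ k * R)) / (60 * 4 ^ k) =
          κ k * s ^ 2 / 2 - R * s / 3 + 17 / 60 * 4 ^ k * R ^ 2 := by
        simp only [hκ]
        field_simp
        ring
      linarith
    calc _ ≤ ∫⁻ ξ in {ξ | R ^ 2 < weightedSq l ξ}, ∑' k, ENNReal.ofReal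
          (a k * (V ξ * gaussWeight (c k) ξ)) := by
          refine setLIntegral_mono (Measurable.tsum fun k => hmV _ _) fun ξ hξ => ?_
          obtain ⟨k, hk⟩ := hshell ξ hξ
          exact (ENNReal.ofReal_le_ofReal hk).trans
            (ENNReal.le_tsum (f := fun k => ENNReal.ofReal (a k * (V ξ * gaussWeight (c k) ξ))) k)
      _ ≤ ∫⁻ ξ, ∑' k, ENNReal.ofReal (a k * (V ξ * gaussWeight (c k) ξ)) :=
          setLIntegral_le_lintegral _ _
      _ = ∑' k, ∫⁻ ξ, ENNReal.ofReal (a k * (V ξ * gaussWeight (c k) ξ)) :=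
          lintegral_tsum fun k => (hmV _ _).aemeasurable
      _ ≤ ∑' k, ENNReal.ofReal (B * N * (exp (5 / 4) * exp (-x)) * (1 / 2) ^ k) := by
          refine ENNReal.tsum_le_tsum fun k => ?_
          refine (hlint _ _ (κ k) (exp_pos _).le (hκ0 k) (hκ1 k) (hcκ k)).trans
            (ENNReal.ofReal_le_ofReal ?_)
          have hm := gaussMass_le_rpow_mul (hκ0 k) h0 h1
          have he := shell_exponent_le hP.le hx hR k
          have hsq : 0 < √(κ k) := sqrt_pos.2 (hκ0 k)
          calc _ ≤ a k * (B * (√(κ k))⁻¹ * (κ k ^ (-P / 2) * N)) := by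
                have := exp_pos (-(17 / 60) * 4 ^ k * R ^ 2)
                gcongr
            _ = B * N * (a k * ((√(κ k))⁻¹ * κ k ^ (-P / 2))) := by ring
            _ ≤ B * N * (exp (5 / 4) * exp (-x) * (1 / 2) ^ k) := by
                gcongr
            _ = _ := by ring
      _ = _ := by
          rw [← ENNReal.ofReal_tsum_of_nonneg (fun k => by positivity)
            (summable_geometric_two.mul_left _), tsum_mul_left, tsum_geometric_two]
          congr 1
          ring

end BulkAndTail

/-! ### The Laplace estimate in diagonal coordinates. -/

section DiagonalLaplace

open Real

variable {ι : Type*} [Fintype ι]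

theorem abs_exp_sub_one_le_abs_mul_exp {d e : ℝ} (h : |d| ≤ e) : |exp d - 1| ≤ |d| * exp e := by
  have h1 := add_one_le_exp d
  have h2 := add_one_le_exp (-d)
  have h3 : exp (-d) * exp d = 1 := by rw [← exp_add]; simp
  have hd := exp_pos d
  have he : exp d ≤ exp e := exp_le_exp.2 ((le_abs_self d).trans h)
  have he1 : 1 ≤ exp e := one_le_exp ((abs_nonneg d).trans h)
  rcases le_total 0 d with h0 | h0
  · rw [abs_of_nonneg (by linarith), abs_of_nonneg h0]
    nlinarith
  · rw [abs_of_nonpos (by linarith [exp_le_one_iff.2 h0]), abs_of_nonpos h0]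
    nlinarith

/-- The concave function `F + |ξ|²/2 - S/2` is `0` at the origin and at most `R²/6 - R²/2 = -R²/3`
where the ray crosses `S = R²`; concavity extends this linearly along the ray. -/
theorem tail_le_of_concaveOn {l : ι → ℝ} (h0 : ∀ i, 0 ≤ l i) {R : ℝ} (hR : 0 < R)
    {F : (ι → ℝ) → ℝ} (hF0 : F 0 = 0)
    (hF : ∀ ξ, weightedSq l ξ ≤ R ^ 2 → F ξ + (∑ i, ξ i ^ 2) / 2 ≤ weightedSq l ξ / 6)
    (hL : ConcaveOn ℝ Set.univ fun ξ => F ξ + (∑ i, ξ i ^ 2) / 2 - weightedSq l ξ / 2)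
    {ξ : ι → ℝ} (hξ : R ^ 2 < weightedSq l ξ) :
    F ξ ≤ -(R * √(weightedSq l ξ) / 3) + weightedSq l ξ / 2 - (∑ i, ξ i ^ 2) / 2 := by
  set s := √(weightedSq l ξ) with hs
  have hs2 : weightedSq l ξ = s ^ 2 := (sq_sqrt (weightedSq_nonneg h0 ξ)).symm
  have hRs : R ≤ s := le_sqrt_of_sq_le hξ.le
  have hs0 : 0 < s := hR.trans_le hRs
  have ht0 : 0 < R / s := div_pos hR hs0
  have ht1 : R / s ≤ 1 := (div_le_one hs0).2 hRs
  have hc := hL.2 (Set.mem_univ ξ) (Set.mem_univ 0) ht0.le (sub_nonneg.2 ht1) (by ring)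
  have hS : weightedSq l ((R / s) • ξ) = R ^ 2 := by
    have : weightedSq l ((R / s) • ξ) = (R / s) ^ 2 * weightedSq l ξ := by
      rw [weightedSq, weightedSq, Finset.mul_sum]
      refine Finset.sum_congr rfl fun i _ => ?_
      rw [Pi.smul_apply, smul_eq_mul]
      ring
    rw [this, hs2]
    field_simp
  have hz : weightedSq l (0 : ι → ℝ) = 0 := by simp [weightedSq]
  have hb := hF ((R / s) • ξ) hS.le
  simp only [smul_zero, add_zero, smul_eq_mul, hF0, hz] at hc
  rw [hS] at hc hb
  simp only [Pi.zero_apply, ne_eq, OfNat.ofNat_ne_zero, not_false_eq_true, zero_pow,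
    Finset.sum_const_zero, zero_div, sub_zero, mul_zero, add_zero] at hc
  rw [hs2] at hc ⊢
  have h1 : R / s * (F ξ + (∑ i, ξ i ^ 2) / 2 - s ^ 2 / 2) ≤ -(R ^ 2 / 3) := by linarith
  have h2 : R / s * (F ξ + (∑ i, ξ i ^ 2) / 2 - s ^ 2 / 2) =
      R * (F ξ + (∑ i, ξ i ^ 2) / 2 - s ^ 2 / 2) / s := by ring
  rw [h2, div_le_iff₀ hs0] at h1
  have h3 : R * (F ξ + (∑ i, ξ i ^ 2) / 2 - s ^ 2 / 2) ≤ R * (-(R * s / 3)) := by linarith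
  have h4 := le_of_mul_le_mul_left h3 hR
  linarith

/-- Integrability and a tail bound for `V * exp F`, where `V` is a weight with controlled Gaussian
moments, `F` is close to a Gaussian log-density on `{weightedSq l ≤ R ^ 2}`, and `F` decays at a
linear rate outside. -/
theorem integrable_mul_exp_and_tail_le {l : ι → ℝ} (h0 : ∀ i, 0 ≤ l i) (h1 : ∀ i, l i ≤ 1)
    {x R w : ℝ} (hx : 0 ≤ x) (hR0 : 0 < R) (hR : 16 / 9 * (4 * ∑ i, l i + 2 * x) ≤ R ^ 2)
    (hw0 : 0 ≤ w) (hw : w ≤ 1 / 3) {V F : (ι → ℝ) → ℝ} (hVm : Measurable V) (hV0 : ∀ ξ, 0 ≤ V ξ)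
    {B : ℝ} (hB : 0 ≤ B)
    (hV : ∀ (c : ι → ℝ) (k : ℝ), 0 < k → k ≤ 1 → (∀ i, k ≤ c i) →
      Integrable (fun ξ => V ξ * gaussWeight c ξ) ∧
        ∫ ξ, V ξ * gaussWeight c ξ ≤ B * (√k)⁻¹ * gaussMass c)
    (hFm : Measurable F)
    (hFU : ∀ ξ, weightedSq l ξ ≤ R ^ 2 → F ξ + (∑ i, ξ i ^ 2) / 2 ≤ w * weightedSq l ξ / 2)
    (hF : ∀ ξ, R ^ 2 < weightedSq l ξ →
      F ξ ≤ -(R * √(weightedSq l ξ) / 3) + weightedSq l ξ / 2 - (∑ i, ξ i ^ 2) / 2) :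
    Integrable (fun ξ => V ξ * exp (F ξ)) ∧
      ∫ ξ in {ξ | R ^ 2 < weightedSq l ξ}, V ξ * exp (F ξ) ≤
        2 * exp (5 / 4) * B * exp (-x) * gaussMass (1 : ι → ℝ) := by
  have hN := gaussMass_pos (c := (1 : ι → ℝ)) fun _ => one_pos
  have hmeas : MeasurableSet {ξ : ι → ℝ | R ^ 2 < weightedSq l ξ} :=
    measurableSet_lt measurable_const (continuous_weightedSq l).measurable
  have hm : Measurable fun ξ => V ξ * exp (F ξ) := hVm.mul hFm.exp
  have hpos : ∀ ξ, 0 ≤ V ξ * exp (F ξ) := fun ξ => mul_nonneg (hV0 ξ) (exp_pos _).le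
  have htail := lintegral_tail_le h0 h1 hx hR0 hR hVm hV0 hB hV hF
  have hi1 : IntegrableOn (fun ξ => V ξ * exp (F ξ)) {ξ | R ^ 2 < weightedSq l ξ} := by
    refine ⟨hm.aestronglyMeasurable, ?_⟩
    rw [hasFiniteIntegral_iff_ofReal (.of_forall hpos)]
    exact htail.trans_lt ENNReal.ofReal_lt_top
  -- On the bulk `V e^F` is dominated by `V` times a Gaussian with precisions at least `1 - w`.
  have hi2 : IntegrableOn (fun ξ => V ξ * exp (F ξ)) {ξ | R ^ 2 < weightedSq l ξ}ᶜ := by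
    have hc : ∀ i, 1 - w ≤ 1 - w * l i := fun i => by nlinarith [h1 i]
    obtain ⟨hi, -⟩ := hV (fun i => 1 - w * l i) (1 - w) (by linarith) (by linarith) hc
    refine hi.integrableOn.mono' hm.aestronglyMeasurable ?_
    refine (ae_restrict_iff' hmeas.compl).2 (.of_forall fun ξ hξ => ?_)
    rw [norm_of_nonneg (hpos ξ), gaussWeight_one_sub]
    refine mul_le_mul_of_nonneg_left (exp_le_exp.2 ?_) (hV0 ξ)
    have := hFU ξ (not_lt.1 hξ)
    linarith
  refine ⟨by simpa using hi1.union hi2, ?_⟩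
  rw [integral_eq_lintegral_of_nonneg_ae (.of_forall hpos) hm.aestronglyMeasurable]
  exact ENNReal.toReal_le_of_le_ofReal (by positivity) htail

/-- The integrand is odd and the set is invariant under `ξ ↦ -ξ`. -/
theorem integral_setOf_weightedSq_le_linear_mul_gaussWeight (l z : ι → ℝ) (r : ℝ) :
    ∫ ξ in {ξ : ι → ℝ | r < weightedSq l ξ}ᶜ, (∑ i, z i * ξ i) * gaussWeight 1 ξ = 0 := by
  have hmeas : MeasurableSet {ξ : ι → ℝ | r < weightedSq l ξ} :=
    measurableSet_lt measurable_const (continuous_weightedSq l).measurable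
  rw [← integral_indicator hmeas.compl]
  set g := Set.indicator {ξ : ι → ℝ | r < weightedSq l ξ}ᶜ
    fun ξ => (∑ i, z i * ξ i) * gaussWeight 1 ξ with hg
  have hodd : ∀ ξ, g (-ξ) = -g ξ := by
    intro ξ
    have hS : weightedSq l (-ξ) = weightedSq l ξ := by simp [weightedSq]
    have hG : gaussWeight 1 (-ξ) = gaussWeight 1 ξ := by simp [gaussWeight]
    simp only [hg, Set.indicator_apply, Set.mem_compl_iff, Set.mem_ofPred_eq, hS, hG]
    split_ifs <;> simp
  have h := integral_neg_eq_self g volume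
  simp_rw [hodd, integral_neg] at h
  linarith

/-- The absolute constant in front of `exp (-x)`. -/
noncomputable def laplaceTailConst : ℝ := 8 * exp (5 / 4) * exp (1 / 2)

/-- The accuracy of the Laplace approximation of the mean, in coordinates that diagonalize both
quadratic forms. -/
theorem diagonal_laplace_mean {l : ι → ℝ} (h0 : ∀ i, 0 ≤ l i) (h1 : ∀ i, l i ≤ 1) {x τ w : ℝ}
    (hx : 0 < x) (hτ0 : 0 ≤ τ) (hτ : τ * (2 * √(∑ i, l i) + √(2 * x)) ≤ 3 / 4)
    (hw : w * ∑ i, l i ≤ 2 / 3) {F : (ι → ℝ) → ℝ} (hFm : Measurable F)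
    (hF1 : ∀ ξ, weightedSq l ξ ≤ (4 / 3 * (2 * √(∑ i, l i) + √(2 * x))) ^ 2 →
      |F ξ + (∑ i, ξ i ^ 2) / 2| ≤ τ / 6 * √(weightedSq l ξ) ^ 3)
    (hF2 : ∀ ξ, weightedSq l ξ ≤ (4 / 3 * (2 * √(∑ i, l i) + √(2 * x))) ^ 2 →
      |F ξ + (∑ i, ξ i ^ 2) / 2| ≤ w * weightedSq l ξ / 2)
    (hL : ConcaveOn ℝ Set.univ fun ξ => F ξ + (∑ i, ξ i ^ 2) / 2 - weightedSq l ξ / 2) :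
    Integrable (fun ξ => exp (F ξ)) ∧ 0 < ∫ ξ, exp (F ξ) ∧
      ∀ z : ι → ℝ, Integrable (fun ξ => (∑ i, z i * ξ i) * exp (F ξ)) ∧
        |∫ ξ, (∑ i, z i * ξ i) * exp (F ξ)| ≤
          (2.4 * τ * √(∑ i, l i + 1) ^ 3 + laplaceTailConst * exp (-x)) * √(∑ i, z i ^ 2) *
            ∫ ξ, exp (F ξ) := by
  set P := ∑ i, l i with hPd
  have hP0 : 0 ≤ P := Finset.sum_nonneg fun i _ => h0 i
  set R := 4 / 3 * (2 * √P + √(2 * x)) with hRd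
  have hsx : 0 < √(2 * x) := sqrt_pos.2 (by linarith)
  have hsP : 0 ≤ √P := sqrt_nonneg P
  have hR0 : 0 < R := by positivity
  have hR : 16 / 9 * (4 * P + 2 * x) ≤ R ^ 2 := by
    have e1 : √P ^ 2 = P := sq_sqrt hP0
    have e2 : √(2 * x) ^ 2 = 2 * x := sq_sqrt (by linarith)
    rw [hRd]
    nlinarith [mul_nonneg hsP hsx.le]
  have hτR : τ * R ≤ 1 := by rw [hRd]; linarith
  have hF3 : ∀ ξ, weightedSq l ξ ≤ R ^ 2 →
      |F ξ + (∑ i, ξ i ^ 2) / 2| ≤ weightedSq l ξ / 6 := by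
    intro ξ hξ
    refine (hF1 ξ hξ).trans ?_
    have hs : √(weightedSq l ξ) ≤ R := sqrt_le_iff.2 ⟨hR0.le, hξ⟩
    have hs0 := sqrt_nonneg (weightedSq l ξ)
    have hs2 := sq_sqrt (weightedSq_nonneg h0 ξ)
    have h4 : τ * √(weightedSq l ξ) ≤ 1 := (mul_le_mul_of_nonneg_left hs hτ0).trans hτR
    calc τ / 6 * √(weightedSq l ξ) ^ 3 =
          (τ * √(weightedSq l ξ)) * √(weightedSq l ξ) ^ 2 / 6 := by ring
      _ ≤ 1 * √(weightedSq l ξ) ^ 2 / 6 := by gcongr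
      _ = _ := by rw [hs2, one_mul]
  -- For `P ≤ 2` the cubic bound with `τ R ≤ 1` already gives `v = 1/3`. For `P > 2` the hypothesis
  -- on `w` gives `v = 2 / (3P)`, which is then below `1/3`.
  obtain ⟨v, hv0, hv1, hv2, hv3, hFv⟩ : ∃ v : ℝ, 0 ≤ v ∧ v ≤ 1 / 3 ∧ v * P ≤ 2 / 3 ∧
      v * (P + 1) ≤ 1 ∧ ∀ ξ, weightedSq l ξ ≤ R ^ 2 →
        |F ξ + (∑ i, ξ i ^ 2) / 2| ≤ v * weightedSq l ξ / 2 := by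
    rcases le_or_gt P 2 with hP | hP
    · refine ⟨1 / 3, by norm_num, le_rfl, by linarith, by linarith, fun ξ hξ => ?_⟩
      have := hF3 ξ hξ
      linarith
    · have hvP : 2 / (3 * P) * P = 2 / 3 := by field_simp
      have hv : 2 / (3 * P) ≤ 1 / 3 := by
        rw [div_le_iff₀ (by positivity)]
        linarith
      refine ⟨2 / (3 * P), by positivity, hv, hvP.le, by linarith, fun ξ hξ => ?_⟩
      refine (hF2 ξ hξ).trans ?_
      have hwv : w ≤ 2 / (3 * P) := by
        rw [le_div_iff₀ (by positivity)]
        linarith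
      have := weightedSq_nonneg h0 ξ
      gcongr
  have hz0 : weightedSq l (0 : ι → ℝ) = 0 := by simp [weightedSq]
  have hF0 : F 0 = 0 := by
    have := hF3 0 (by rw [hz0]; positivity)
    rw [hz0] at this
    simpa using this
  have htl : ∀ ξ, R ^ 2 < weightedSq l ξ →
      F ξ ≤ -(R * √(weightedSq l ξ) / 3) + weightedSq l ξ / 2 - (∑ i, ξ i ^ 2) / 2 := fun ξ hξ =>
    tail_le_of_concaveOn h0 hR0 hF0 (fun ξ hξ => (le_abs_self _).trans (hF3 ξ hξ)) hL hξ
  have hFvU : ∀ ξ, weightedSq l ξ ≤ R ^ 2 →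
      F ξ + (∑ i, ξ i ^ 2) / 2 ≤ v * weightedSq l ξ / 2 := fun ξ hξ =>
    (le_abs_self _).trans (hFv ξ hξ)
  have hN := gaussMass_pos (c := (1 : ι → ℝ)) fun _ => one_pos
  set N := gaussMass (1 : ι → ℝ) with hNd
  have hG1 : ∀ ξ : ι → ℝ, gaussWeight 1 ξ = exp (-(∑ i, ξ i ^ 2) / 2) := fun ξ => by
    simp [gaussWeight]
  have hFe : ∀ ξ, exp (F ξ) = exp (F ξ + (∑ i, ξ i ^ 2) / 2) * gaussWeight 1 ξ := fun ξ => by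
    rw [hG1, ← exp_add]
    congr 1
    ring
  have hint : Integrable fun ξ => exp (F ξ) := by
    have h := (integrable_mul_exp_and_tail_le h0 h1 hx.le hR0 hR hv0 hv1 (V := fun _ => 1) (B := 1)
      measurable_const (fun _ => zero_le_one) zero_le_one ?_ hFm hFvU htl).1
    · simpa using h
    · intro c k hk hk1 hc
      have hc0 : ∀ i, 0 < c i := fun i => hk.trans_le (hc i)
      simp only [one_mul]
      refine ⟨integrable_gaussWeight hc0, ?_⟩
      rw [integral_gaussWeight hc0]
      refine le_mul_of_one_le_left (gaussMass_pos hc0).le ?_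
      exact (one_le_inv₀ (sqrt_pos.2 hk)).2 (sqrt_le_one.2 hk1)
  -- The minorant `(1 - (v/2 + 1/R²) S)` times the Gaussian comes from `e^t ≥ 1 + t` on the bulk and
  -- is nonpositive off it. Its mass is at least `1 - 1/3 - 9/64 = 101/192` of `N`.
  have hden : 101 / 192 * N ≤ ∫ ξ, exp (F ξ) := by
    obtain ⟨i1, e1⟩ := integral_one_sub_weightedSq_mul_gaussWeight l (v / 2 + 1 / R ^ 2)
    have hR2 : 0 < R ^ 2 := by positivity
    have hPR : 1 / R ^ 2 * P ≤ 9 / 64 := by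
      rw [one_div, inv_mul_le_iff₀ hR2]
      linarith
    calc 101 / 192 * N ≤ (1 - (v / 2 + 1 / R ^ 2) * P) * N := by
          refine mul_le_mul_of_nonneg_right ?_ hN.le
          linarith
      _ = _ := e1.symm
      _ ≤ _ := by
          refine integral_mono i1 hint fun ξ => ?_
          simp only
          have hS := weightedSq_nonneg h0 ξ
          have hg := gaussWeight_pos 1 ξ
          rcases le_or_gt (weightedSq l ξ) (R ^ 2) with h | h
          · rw [hFe]
            refine mul_le_mul_of_nonneg_right ?_ hg.le
            have e2 := add_one_le_exp (F ξ + (∑ i, ξ i ^ 2) / 2)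
            have e3 := (abs_le.1 (hFv ξ h)).1
            have e4 : 0 ≤ 1 / R ^ 2 * weightedSq l ξ := by positivity
            linarith
          · refine le_trans (mul_nonpos_of_nonpos_of_nonneg ?_ hg.le) (exp_pos _).le
            have e4 : 1 ≤ 1 / R ^ 2 * weightedSq l ξ := by
              rw [one_div, ← div_eq_inv_mul, one_le_div hR2]
              exact h.le
            have e5 : 0 ≤ v / 2 * weightedSq l ξ := by positivity
            linarith
  refine ⟨hint, lt_of_lt_of_le (by positivity) hden, fun z => ?_⟩
  set σ := √(∑ i, z i ^ 2) with hσ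
  have hσ0 : 0 ≤ σ := sqrt_nonneg _
  set U : Set (ι → ℝ) := {ξ | R ^ 2 < weightedSq l ξ}ᶜ with hU
  have hmeas : MeasurableSet U :=
    (measurableSet_lt measurable_const (continuous_weightedSq l).measurable).compl
  obtain ⟨hiV, htV⟩ := integrable_mul_exp_and_tail_le h0 h1 hx.le hR0 hR hv0 hv1
    (V := fun ξ => |∑ i, z i * ξ i|) (B := 2 * exp (1 / 2) * σ)
    (by fun_prop) (fun _ => abs_nonneg _) (by positivity)
    (fun c k hk _ hc => ⟨integrable_abs_linear_mul_gaussWeight (fun i => hk.trans_le (hc i)) z,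
      integral_abs_linear_mul_gaussWeight_le hk hc z⟩) hFm hFvU htl
  have hiZ : Integrable fun ξ => (∑ i, z i * ξ i) * exp (F ξ) := by
    refine hiV.mono' ((by fun_prop : Measurable fun ξ : ι → ℝ => ∑ i, z i * ξ i).mul
      hFm.exp).aestronglyMeasurable (.of_forall fun ξ => ?_)
    rw [norm_mul, norm_eq_abs, norm_of_nonneg (exp_pos _).le]
  refine ⟨hiZ, ?_⟩
  have hiG : Integrable fun ξ : ι → ℝ => (∑ i, z i * ξ i) * gaussWeight 1 ξ := by
    refine (integrable_abs_linear_mul_gaussWeight (c := (1 : ι → ℝ)) (fun _ => one_pos) z).mono'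
      (by fun_prop) (.of_forall fun ξ => ?_)
    rw [norm_mul, norm_eq_abs, norm_of_nonneg (gaussWeight_pos _ _).le]
  have hc0 : ∀ i, 0 < 1 - v * l i := fun i => by nlinarith [h1 i]
  have hbulk : |∫ ξ in U, (∑ i, z i * ξ i) * exp (F ξ)| ≤
      τ / 6 * (15 / 2 * σ * √(P + 1) ^ 3 * N) := by
    -- Subtracting the Gaussian changes nothing by oddness, and leaves the small factor `e^{F +
    -- |ξ|²/2} - 1`.
    have e1 : ∫ ξ in U, (∑ i, z i * ξ i) * exp (F ξ) =
        ∫ ξ in U, ((∑ i, z i * ξ i) * exp (F ξ) - (∑ i, z i * ξ i) * gaussWeight 1 ξ) := by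
      rw [integral_sub hiZ.integrableOn hiG.integrableOn, hU,
        integral_setOf_weightedSq_le_linear_mul_gaussWeight, sub_zero]
    have i3 := integrable_abs_linear_mul_sqrt_pow_three hc0 h0 z
    rw [e1, ← norm_eq_abs]
    calc _ ≤ ∫ ξ in U, τ / 6 * (|∑ i, z i * ξ i| * √(weightedSq l ξ) ^ 3 *
          gaussWeight (fun i => 1 - v * l i) ξ) := by
          refine norm_integral_le_of_norm_le (i3.const_mul _).integrableOn ?_
          refine (ae_restrict_iff' hmeas).2 (.of_forall fun ξ hξ => ?_)
          have hξ' : weightedSq l ξ ≤ R ^ 2 := not_lt.1 hξ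
          have hg := gaussWeight_pos 1 ξ
          have e3 : gaussWeight (fun i => 1 - v * l i) ξ =
              exp (v * weightedSq l ξ / 2) * gaussWeight 1 ξ := by
            rw [gaussWeight_one_sub, hG1, ← exp_add]
            congr 1
            ring
          rw [← mul_sub, hFe, ← sub_one_mul, norm_mul, norm_mul, norm_of_nonneg hg.le, norm_eq_abs,
            norm_eq_abs, e3]
          calc _ ≤ |∑ i, z i * ξ i| * (τ / 6 * √(weightedSq l ξ) ^ 3 *
                exp (v * weightedSq l ξ / 2) * gaussWeight 1 ξ) := by
                gcongr
                refine (abs_exp_sub_one_le_abs_mul_exp (hFv ξ hξ')).trans ?_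
                gcongr
                exact hF1 ξ hξ'
            _ = _ := by ring
      _ ≤ ∫ ξ, τ / 6 * (|∑ i, z i * ξ i| * √(weightedSq l ξ) ^ 3 *
          gaussWeight (fun i => 1 - v * l i) ξ) := by
          refine setIntegral_le_integral (i3.const_mul _) (.of_forall fun ξ => ?_)
          have hg := gaussWeight_pos (fun i => 1 - v * l i) ξ
          simp only [Pi.zero_apply]
          positivity
      _ ≤ _ := by
          rw [integral_const_mul]
          gcongr
          exact integral_abs_linear_mul_sqrt_pow_three_le h0 h1 hv0 hv1 hv2 hv3 z
  have htail : |∫ ξ in Uᶜ, (∑ i, z i * ξ i) * exp (F ξ)| ≤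
      2 * exp (5 / 4) * (2 * exp (1 / 2) * σ) * exp (-x) * N := by
    rw [hU, compl_compl]
    refine le_trans ?_ htV
    refine (abs_integral_le_integral_abs).trans_eq ?_
    simp_rw [abs_mul, abs_exp]
  calc |∫ ξ, (∑ i, z i * ξ i) * exp (F ξ)| ≤ τ / 6 * (15 / 2 * σ * √(P + 1) ^ 3 * N) +
        2 * exp (5 / 4) * (2 * exp (1 / 2) * σ) * exp (-x) * N := by
        rw [← integral_add_compl hmeas hiZ]
        exact (abs_add_le _ _).trans (add_le_add hbulk htail)
    -- The lower bound for the denominator is factored out: `192/101 · 5/4 ≤ 2.4` and `192/101 · 4 ≤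
    -- 8`.
    _ = (192 / 101 * (5 / 4) * τ * √(P + 1) ^ 3 +
          192 / 101 * 4 * exp (5 / 4) * exp (1 / 2) * exp (-x)) * σ * (101 / 192 * N) := by ring
    _ ≤ (2.4 * τ * √(P + 1) ^ 3 + 8 * exp (5 / 4) * exp (1 / 2) * exp (-x)) * σ *
          (101 / 192 * N) := by
        gcongr <;> norm_num
    _ ≤ _ := by
        rw [laplaceTailConst]
        gcongr

end DiagonalLaplace

/-! ### Taylor expansion and concavity along lines. -/

section LineTaylor

theorem iteratedDeriv_comp_line {E : Type*} [NormedAddCommGroup E] [NormedSpace ℝ E] {f : E → ℝ}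
    {n : ℕ} (hf : ContDiff ℝ n f) (a u : E) {k : ℕ} (hk : k ≤ n) (t : ℝ) :
    iteratedDeriv k (fun s : ℝ => f (a + s • u)) t =
      iteratedFDeriv ℝ k f (a + t • u) fun _ => u := by
  have h1 : (fun s : ℝ => f (a + s • u)) =
      (fun y => f (a + y)) ∘ (ContinuousLinearMap.toSpanSingleton ℝ u) := by
    ext s
    simp
  have hf' : ContDiff ℝ n fun y => f (a + y) := hf.comp (contDiff_const.add contDiff_id)
  rw [iteratedDeriv_eq_iteratedFDeriv, h1,
    ContinuousLinearMap.iteratedFDeriv_comp_right _ hf' t (by exact_mod_cast hk),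
    iteratedFDeriv_comp_add_left]
  simp

theorem abs_sub_quadratic_le_of_iteratedDeriv_three_le {g : ℝ → ℝ} (hg : ContDiff ℝ 3 g) {K : ℝ}
    (hK : ∀ t ∈ Set.Icc (0 : ℝ) 1, |iteratedDeriv 3 g t| ≤ K) :
    |g 1 - g 0 - deriv g 0 - iteratedDeriv 2 g 0 / 2| ≤ K / 6 := by
  obtain ⟨t, ht, h⟩ := taylor_mean_remainder_lagrange_iteratedDeriv (f := g) (x := 1) (x₀ := 0)
    (n := 2) zero_ne_one (by exact_mod_cast hg.contDiffOn)
  rw [Set.uIoo_of_le zero_le_one] at ht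
  have hu : UniqueDiffOn ℝ (Set.uIcc (0 : ℝ) 1) := uniqueDiffOn_uIcc zero_ne_one
  have hd : ∀ k : ℕ, k ≤ 3 →
      iteratedDerivWithin k g (Set.uIcc (0 : ℝ) 1) 0 = iteratedDeriv k g 0 := fun k hk =>
    iteratedDerivWithin_eq_iteratedDeriv hu
      ((hg.of_le (by exact_mod_cast hk)).contDiffAt) (by simp)
  have e : taylorWithinEval g 2 (Set.uIcc (0 : ℝ) 1) 0 1 =
      g 0 + deriv g 0 + iteratedDeriv 2 g 0 / 2 := by
    simp only [taylorWithinEval_succ, taylor_within_zero_eval, hd _ (by norm_num : 0 + 1 ≤ 3),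
      hd _ (by norm_num : 1 + 1 ≤ 3)]
    norm_num [iteratedDeriv_one]
    ring
  rw [e] at h
  have h2 : g 1 - g 0 - deriv g 0 - iteratedDeriv 2 g 0 / 2 = iteratedDeriv 3 g t / 6 := by
    norm_num [Nat.factorial] at h ⊢
    linarith
  rw [h2, abs_div, abs_of_pos (by norm_num : (0 : ℝ) < 6)]
  exact div_le_div_of_nonneg_right (hK t ⟨ht.1.le, ht.2.le⟩) (by norm_num)

theorem iteratedDeriv_two_nonpos_of_concaveOn {g : ℝ → ℝ} (hg : Differentiable ℝ g)
    (hc : ConcaveOn ℝ Set.univ g) (t : ℝ) : iteratedDeriv 2 g t ≤ 0 := by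
  have h : AntitoneOn (deriv g) Set.univ := hc.antitoneOn_deriv fun x _ => hg x
  rw [iteratedDeriv_succ, iteratedDeriv_one]
  exact (antitoneOn_univ.1 h).deriv_nonpos
end LineTaylor

/-! ### The quadratic forms `D_G²` and `D²`, and the cubic Taylor bound. -/

section QuadraticForms

open WithLp

variable {p : ℕ}

/-- Take `A = H^{-1/2} U` with `U` an orthogonal eigenbasis of `H^{-1/2} K H^{-1/2}`. -/
theorem exists_simultaneous_diagonalization {H K : Matrix (Fin p) (Fin p) ℝ} (hH : H.PosDef)
    (hK : K.IsHermitian) :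
    ∃ (A : Matrix (Fin p) (Fin p) ℝ) (l : Fin p → ℝ), Aᵀ * H * A = 1 ∧
      Aᵀ * K * A = Matrix.diagonal l ∧ A * Aᵀ = H⁻¹ := by
  set B := CFC.sqrt H with hB
  have hBB : B * B = H := CFC.sqrt_mul_sqrt_self H hH.posSemidef.nonneg
  have hBh : Bᵀ = B := by
    have : B.IsHermitian := (Matrix.nonneg_iff_posSemidef.1 (CFC.sqrt_nonneg H)).isHermitian
    simpa [Matrix.IsHermitian, Matrix.conjTranspose_eq_transpose_of_trivial] using this
  have hdet : IsUnit B.det := by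
    have h := hH.det_pos
    rw [← hBB, Matrix.det_mul] at h
    exact isUnit_iff_ne_zero.2 fun h0 => by simp [h0] at h
  have hBi : (B⁻¹)ᵀ = B⁻¹ := by rw [Matrix.transpose_nonsing_inv, hBh]
  have hM : (B⁻¹ * K * B⁻¹).IsHermitian := by
    rw [Matrix.IsHermitian, Matrix.conjTranspose_eq_transpose_of_trivial] at hK ⊢
    rw [Matrix.transpose_mul, Matrix.transpose_mul, hBi, hK, mul_assoc]
  set U : Matrix (Fin p) (Fin p) ℝ := hM.eigenvectorUnitary.1 with hU
  have hUs : star U = Uᵀ := by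
    rw [Matrix.star_eq_conjTranspose, Matrix.conjTranspose_eq_transpose_of_trivial]
  have hU1 : Uᵀ * U = 1 := by
    rw [← hUs]
    exact Unitary.coe_star_mul_self hM.eigenvectorUnitary
  have hU2 : U * Uᵀ = 1 := by
    rw [← hUs]
    exact Unitary.coe_mul_star_self hM.eigenvectorUnitary
  have hspec : B⁻¹ * K * B⁻¹ = U * Matrix.diagonal hM.eigenvalues * Uᵀ := by
    have h := hM.spectral_theorem
    rw [Unitary.conjStarAlgAut_apply] at h
    rw [← hUs]
    exact h
  have h1 : B⁻¹ * B = 1 := Matrix.nonsing_inv_mul B hdet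
  have h2 : B * B⁻¹ = 1 := Matrix.mul_nonsing_inv B hdet
  refine ⟨B⁻¹ * U, hM.eigenvalues, ?_, ?_, ?_⟩
  · rw [Matrix.transpose_mul, hBi, ← hBB]
    calc _ = Uᵀ * ((B⁻¹ * B) * (B * B⁻¹)) * U := by simp only [mul_assoc]
      _ = 1 := by rw [h1, h2, mul_one, mul_one, hU1]
  · rw [Matrix.transpose_mul, hBi]
    calc _ = Uᵀ * (B⁻¹ * K * B⁻¹) * U := by simp only [mul_assoc]
      _ = (Uᵀ * U) * Matrix.diagonal hM.eigenvalues * (Uᵀ * U) := by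
          have h := congrArg (fun X => Uᵀ * X * U) hspec
          simpa only [mul_assoc] using h
      _ = _ := by rw [hU1, one_mul, mul_one]
  · rw [Matrix.transpose_mul, hBi, ← hBB, Matrix.mul_inv_rev]
    calc _ = B⁻¹ * (U * Uᵀ) * B⁻¹ := by simp only [mul_assoc]
      _ = _ := by rw [hU2, mul_one]

theorem norm_toEuclideanLin_sq {m : ℕ} (M : Matrix (Fin m) (Fin p) ℝ) (u : EuclideanSpace ℝ (Fin p)) :
    ‖Matrix.toEuclideanLin M u‖ ^ 2 = ofLp u ⬝ᵥ (Mᵀ * M) *ᵥ ofLp u := by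
  rw [EuclideanSpace.real_norm_sq_eq, ← Matrix.mulVec_mulVec, Matrix.dotProduct_mulVec,
    Matrix.vecMul_transpose, dotProduct]
  refine Finset.sum_congr rfl fun i _ => ?_
  rw [Matrix.ofLp_toLpLin, Matrix.toLin'_apply, sq]

theorem iteratedFDeriv_two_eq_neg_negHessian {f : EuclideanSpace ℝ (Fin p) → ℝ}
    (x u : EuclideanSpace ℝ (Fin p)) :
    iteratedFDeriv ℝ 2 f x (fun _ => u) = -(ofLp u ⬝ᵥ negHessian f x *ᵥ ofLp u) := by
  have hu : u = ∑ i, u i • EuclideanSpace.single i (1 : ℝ) := by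
    have := (EuclideanSpace.basisFun (Fin p) ℝ).sum_repr u
    simpa using this.symm
  set b := fderiv ℝ (fderiv ℝ f) x with hb
  have hH : ∀ i j, negHessian f x i j =
      -b (EuclideanSpace.single i 1) (EuclideanSpace.single j 1) := fun i j => by
    simp [negHessian, iteratedFDeriv_two_apply, hb]
  rw [iteratedFDeriv_two_apply, ← hb]
  conv_lhs => rw [hu]
  simp only [map_sum, map_smul, sum_apply, smul_apply, smul_eq_mul, dotProduct, Matrix.mulVec, hH,
    Finset.mul_sum, ← Finset.sum_neg_distrib]
  rw [Finset.sum_comm]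
  refine Finset.sum_congr rfl fun i _ => Finset.sum_congr rfl fun j _ => ?_
  ring

theorem norm_toEuclideanLin_matD_sq {f : EuclideanSpace ℝ (Fin p) → ℝ}
    {G : Matrix (Fin p) (Fin p) ℝ} {xs : EuclideanSpace ℝ (Fin p)}
    (hK : (negHessian f xs - Gᵀ * G).PosSemidef) (u : EuclideanSpace ℝ (Fin p)) :
    ‖Matrix.toEuclideanLin (matD f G xs) u‖ ^ 2 =
      ofLp u ⬝ᵥ (negHessian f xs - Gᵀ * G) *ᵥ ofLp u := by
  have hDh : (matD f G xs)ᵀ = matD f G xs := by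
    have h : (matD f G xs).IsHermitian :=
      (Matrix.nonneg_iff_posSemidef.1 (CFC.sqrt_nonneg _)).isHermitian
    simpa [Matrix.IsHermitian, Matrix.conjTranspose_eq_transpose_of_trivial] using h
  rw [norm_toEuclideanLin_sq, hDh, matD, CFC.sqrt_mul_sqrt_self _ hK.nonneg]

theorem unpenalized_line (f : EuclideanSpace ℝ (Fin p) → ℝ) (G : Matrix (Fin p) (Fin p) ℝ)
    (xs u : EuclideanSpace ℝ (Fin p)) (t : ℝ) :
    unpenalized f G xs (xs + t • u) =
      f (xs + t • u) + ‖Matrix.toEuclideanLin G u‖ ^ 2 / 2 * t ^ 2 := by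
  rw [unpenalized, add_sub_cancel_left, map_smul, norm_smul, mul_pow, Real.norm_eq_abs, sq_abs]
  ring

theorem contDiff_unpenalized {f : EuclideanSpace ℝ (Fin p) → ℝ} {n : WithTop ℕ∞}
    (hf : ContDiff ℝ n f) (G : Matrix (Fin p) (Fin p) ℝ) (xs : EuclideanSpace ℝ (Fin p)) :
    ContDiff ℝ n (unpenalized f G xs) := by
  have h : ContDiff ℝ n (Matrix.toEuclideanLin G).toContinuousLinearMap :=
    ContinuousLinearMap.contDiff _
  exact hf.add (((h.comp (contDiff_id.sub contDiff_const)).norm_sq ℝ).div_const 2)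

theorem iteratedDeriv_two_unpenalized_line {f : EuclideanSpace ℝ (Fin p) → ℝ}
    (hf : ContDiff ℝ 3 f) (G : Matrix (Fin p) (Fin p) ℝ) (xs u : EuclideanSpace ℝ (Fin p)) :
    iteratedDeriv 2 (fun t : ℝ => unpenalized f G xs (xs + t • u)) 0 =
      -(ofLp u ⬝ᵥ (negHessian f xs - Gᵀ * G) *ᵥ ofLp u) := by
  have hl : ContDiff ℝ 3 fun t : ℝ => f (xs + t • u) :=
    hf.comp (contDiff_const.add (contDiff_id.smul contDiff_const))
  have hq : ∀ a : ℝ, iteratedDeriv 2 (fun t : ℝ => a * t ^ 2) 0 = 2 * a := fun a => by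
    rw [iteratedDeriv_const_mul_field, iteratedDeriv_pow]
    simp [Nat.descFactorial]
    ring
  have hqc : ContDiff ℝ 2 fun t : ℝ => ‖Matrix.toEuclideanLin G u‖ ^ 2 / 2 * t ^ 2 := by fun_prop
  simp_rw [unpenalized_line]
  rw [iteratedDeriv_fun_add (hl.of_le (by norm_num)).contDiffAt hqc.contDiffAt, hq,
    iteratedDeriv_comp_line (n := 3) (by exact_mod_cast hf) xs u (by norm_num), zero_smul, add_zero,
    iteratedFDeriv_two_eq_neg_negHessian, norm_toEuclideanLin_sq, Matrix.sub_mulVec,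
    dotProduct_sub]
  ring

theorem deriv_unpenalized_line {f : EuclideanSpace ℝ (Fin p) → ℝ} (hf : ContDiff ℝ 3 f)
    (G : Matrix (Fin p) (Fin p) ℝ) {xs : EuclideanSpace ℝ (Fin p)} (hmax : ∀ y, f y ≤ f xs)
    (u : EuclideanSpace ℝ (Fin p)) :
    deriv (fun t : ℝ => unpenalized f G xs (xs + t • u)) 0 = 0 := by
  have hl : ContDiff ℝ 3 fun t : ℝ => f (xs + t • u) :=
    hf.comp (contDiff_const.add (contDiff_id.smul contDiff_const))
  have h0 : deriv (fun t : ℝ => f (xs + t • u)) 0 = 0 := by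
    refine IsLocalMax.deriv_eq_zero (.of_forall fun t => ?_)
    simpa using hmax _
  simp_rw [unpenalized_line]
  rw [deriv_fun_add (hl.differentiable (by norm_num)).differentiableAt (by fun_prop), h0]
  simp

/-- The matrix is `-∇²ℓ(x*)`, and `ℓ` is concave on every line. This makes the square root in `matD`
a genuine one. -/
theorem posSemidef_negHessian_sub {f : EuclideanSpace ℝ (Fin p) → ℝ} (hf : ContDiff ℝ 3 f)
    {G : Matrix (Fin p) (Fin p) ℝ} {xs : EuclideanSpace ℝ (Fin p)}
    (hH : (negHessian f xs).IsHermitian) (hc : ConcaveOn ℝ Set.univ (unpenalized f G xs)) :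
    (negHessian f xs - Gᵀ * G).PosSemidef := by
  have hGG : (Gᵀ * G).IsHermitian := by
    simpa [Matrix.conjTranspose_eq_transpose_of_trivial] using
      Matrix.isHermitian_conjTranspose_mul_self G
  refine Matrix.PosSemidef.of_dotProduct_mulVec_nonneg (hH.sub hGG) fun v => ?_
  have hline : ConcaveOn ℝ Set.univ fun t : ℝ => unpenalized f G xs (xs + t • toLp 2 v) := by
    have h := hc.comp_affineMap (AffineMap.lineMap (k := ℝ) xs (xs + toLp 2 v))
    convert! h using 2 with t
    simp [AffineMap.lineMap_apply, add_comm]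
  have hd : ContDiff ℝ 3 fun t : ℝ => unpenalized f G xs (xs + t • toLp 2 v) :=
    (contDiff_unpenalized hf G xs).comp (contDiff_const.add (contDiff_id.smul contDiff_const))
  have h := iteratedDeriv_two_nonpos_of_concaveOn (hd.differentiable (by norm_num)) hline 0
  rw [iteratedDeriv_two_unpenalized_line hf] at h
  simpa using h

/-- The penalty is quadratic, so `f` and `ℓ = -n h` have the same second-order remainder at `x*`,
and the gradient vanishes there. Lagrange's remainder for `h` along the segment, with `⟨∇²h(x*),
u^{⊗2}⟩ = ‖Du‖² / n`, gives the bound after multiplication by `n`. -/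
theorem abs_taylor_le_of_selfConcordant {f : EuclideanSpace ℝ (Fin p) → ℝ} (hf : ContDiff ℝ 3 f)
    {G : Matrix (Fin p) (Fin p) ℝ} {xs : EuclideanSpace ℝ (Fin p)} {ν x n c₃ : ℝ} (hn : 0 < n)
    (hmax : ∀ y, f y ≤ f xs) (hK : (negHessian f xs - Gᵀ * G).PosSemidef)
    (hsc : SelfConcordant f G xs ν x n c₃) {u : EuclideanSpace ℝ (Fin p)}
    (hu : u ∈ localSet f G xs ν x) :
    |f (xs + u) - f xs + (ofLp u ⬝ᵥ negHessian f xs *ᵥ ofLp u) / 2| ≤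
      c₃ * n ^ (-(1 / 2) : ℝ) / 6 * ‖Matrix.toEuclideanLin (matD f G xs) u‖ ^ 3 := by
  set h : EuclideanSpace ℝ (Fin p) → ℝ := fun y => -unpenalized f G xs y / n with hh
  have hhc : ContDiff ℝ 3 h := ((contDiff_unpenalized hf G xs).neg).div_const n
  set d := ‖Matrix.toEuclideanLin (matD f G xs) u‖ with hd
  have hd2 := norm_toEuclideanLin_matD_sq hK u
  rw [← hd] at hd2
  have hd0 : 0 ≤ d := norm_nonneg _
  set φ := fun t : ℝ => unpenalized f G xs (xs + t • u) with hφ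
  have hg : (fun t : ℝ => h (xs + t • u)) = fun t => (-1 / n) * φ t := by
    ext t
    simp only [hh, hφ]
    ring
  have hφc : ContDiff ℝ 3 φ :=
    (contDiff_unpenalized hf G xs).comp (contDiff_const.add (contDiff_id.smul contDiff_const))
  have hφ2 : iteratedDeriv 2 φ 0 = -d ^ 2 := by
    rw [hφ, iteratedDeriv_two_unpenalized_line hf, hd2]
  have hφ1 : deriv φ 0 = 0 := deriv_unpenalized_line hf G hmax u
  have hq : iteratedFDeriv ℝ 2 h xs (fun _ => u) = d ^ 2 / n := by
    have := iteratedDeriv_comp_line (n := 3) (by exact_mod_cast hhc) xs u (k := 2) (by norm_num) 0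
    rw [zero_smul, add_zero, hg, iteratedDeriv_const_mul_field, hφ2] at this
    rw [← this]
    ring
  have hbound : ∀ t ∈ Set.Icc (0 : ℝ) 1,
      |iteratedDeriv 3 (fun t : ℝ => h (xs + t • u)) t| ≤ c₃ * (d ^ 2 / n) ^ (3 / 2 : ℝ) := by
    intro t ht
    rw [iteratedDeriv_comp_line (n := 3) (by exact_mod_cast hhc) xs u le_rfl t, ← hq]
    exact hsc u hu t ht
  have hpow : n * (d ^ 2 / n) ^ (3 / 2 : ℝ) = n ^ (-(1 / 2) : ℝ) * d ^ 3 := by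
    rw [Real.div_rpow (sq_nonneg d) hn.le, ← Real.rpow_natCast d 2, ← Real.rpow_mul hd0,
      show (-(1 / 2) : ℝ) = 1 - 3 / 2 by norm_num, Real.rpow_sub hn, Real.rpow_one]
    norm_num
    ring
  have hG : d ^ 2 + ‖Matrix.toEuclideanLin G u‖ ^ 2 = ofLp u ⬝ᵥ negHessian f xs *ᵥ ofLp u := by
    rw [hd2, norm_toEuclideanLin_sq, Matrix.sub_mulVec, dotProduct_sub]
    ring
  have hT := abs_sub_quadratic_le_of_iteratedDeriv_three_le (g := fun t => (-1 / n) * φ t)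
    (contDiff_const.mul hφc) (hg ▸ hbound)
  rw [deriv_const_mul_field, iteratedDeriv_const_mul_field, hφ1, hφ2] at hT
  have e1 : φ 1 = f (xs + u) + ‖Matrix.toEuclideanLin G u‖ ^ 2 / 2 := by
    simp [hφ, unpenalized_line]
  have e0 : φ 0 = f xs := by
    simp [hφ, unpenalized_line]
  have e2 : f (xs + u) - f xs + (ofLp u ⬝ᵥ negHessian f xs *ᵥ ofLp u) / 2 =
      -n * ((-1 / n) * φ 1 - (-1 / n) * φ 0 - (-1 / n) * 0 - (-1 / n) * -d ^ 2 / 2) := by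
    rw [e1, e0, ← hG]
    field_simp
    ring
  rw [e2, abs_mul, abs_neg, abs_of_pos hn]
  calc _ ≤ n * (c₃ * (d ^ 2 / n) ^ (3 / 2 : ℝ) / 6) := by gcongr
    _ = c₃ / 6 * (n * (d ^ 2 / n) ^ (3 / 2 : ℝ)) := by ring
    _ = _ := by
        rw [hpow]
        ring

end QuadraticForms

/-! ### Change of variables under the affine chart. -/

section Transport

open WithLp

variable {p : ℕ}

/-- The affine chart `ξ ↦ xs + A ξ`. -/
def affineChart (A : Matrix (Fin p) (Fin p) ℝ) (xs : EuclideanSpace ℝ (Fin p)) (ξ : Fin p → ℝ) :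
    EuclideanSpace ℝ (Fin p) := xs + toLp 2 (A *ᵥ ξ)

theorem continuous_affineChart (A : Matrix (Fin p) (Fin p) ℝ) (xs : EuclideanSpace ℝ (Fin p)) :
    Continuous (affineChart A xs) := by
  unfold affineChart
  fun_prop

theorem map_affineChart_volume {A : Matrix (Fin p) (Fin p) ℝ} (hA : A.det ≠ 0)
    (xs : EuclideanSpace ℝ (Fin p)) :
    Measure.map (affineChart A xs) volume = ENNReal.ofReal |A.det⁻¹| • volume := by
  have h1 := Real.map_matrix_volume_pi_eq_smul_volume_pi hA
  have h2 := (PiLp.volume_preserving_toLp (Fin p)).map_eq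
  have h3 := map_add_left_eq_self (volume : Measure (EuclideanSpace ℝ (Fin p))) xs
  have hm : Measurable (Matrix.toLin' A) := (Matrix.toLin' A).continuous_of_finiteDimensional.measurable
  have e : affineChart A xs = (fun y => xs + y) ∘ (toLp 2) ∘ (Matrix.toLin' A) := by
    ext ξ
    simp [affineChart]
  rw [e, ← Measure.map_map (by fun_prop) ((by fun_prop : Measurable (toLp 2)).comp hm),
    ← Measure.map_map (by fun_prop) hm, h1, Measure.map_smul, h2, Measure.map_smul, h3]

theorem integrable_comp_affineChart {A : Matrix (Fin p) (Fin p) ℝ} (hA : A.det ≠ 0)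
    (xs : EuclideanSpace ℝ (Fin p)) {E : Type*} [NormedAddCommGroup E]
    {g : EuclideanSpace ℝ (Fin p) → E} (hg : Continuous g)
    (h : Integrable fun ξ => g (affineChart A xs ξ)) : Integrable g := by
  have hc : ENNReal.ofReal |A.det⁻¹| ≠ 0 := by
    simpa using hA
  rw [← integrable_smul_measure hc ENNReal.ofReal_ne_top, ← map_affineChart_volume hA xs]
  exact (integrable_map_measure hg.aestronglyMeasurable
    (continuous_affineChart A xs).measurable.aemeasurable).2 h

theorem integral_comp_affineChart {A : Matrix (Fin p) (Fin p) ℝ} (hA : A.det ≠ 0)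
    (xs : EuclideanSpace ℝ (Fin p)) {g : EuclideanSpace ℝ (Fin p) → ℝ} (hg : Continuous g) :
    ∫ ξ, g (affineChart A xs ξ) = |A.det⁻¹| * ∫ y, g y := by
  rw [← integral_map (continuous_affineChart A xs).measurable.aemeasurable
    hg.aestronglyMeasurable, map_affineChart_volume hA xs, integral_smul_measure,
    ENNReal.toReal_ofReal (abs_nonneg _), smul_eq_mul]

end Transport

/-! ### The posterior and its first moments. -/

section Posterior

open WithLp

variable {p : ℕ}

theorem posterior_eq {f : EuclideanSpace ℝ (Fin p) → ℝ}
    (hi : Integrable fun y => Real.exp (f y)) :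
    posterior f = ENNReal.ofReal (∫ y, Real.exp (f y))⁻¹ •
      volume.withDensity fun x => ENNReal.ofReal (Real.exp (f x)) := by
  rw [posterior, withDensity_apply _ MeasurableSet.univ, Measure.restrict_univ,
    ← ofReal_integral_eq_lintegral_ofReal hi (.of_forall fun y => (Real.exp_pos _).le),
    ENNReal.ofReal_inv_of_pos (integral_exp_pos hi)]

theorem isProbabilityMeasure_posterior {f : EuclideanSpace ℝ (Fin p) → ℝ}
    (hi : Integrable fun y => Real.exp (f y)) : IsProbabilityMeasure (posterior f) := by
  constructor
  have h := integral_exp_pos hi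
  rw [posterior, Measure.smul_apply, smul_eq_mul, withDensity_apply _ MeasurableSet.univ,
    Measure.restrict_univ,
    ← ofReal_integral_eq_lintegral_ofReal hi (.of_forall fun y => (Real.exp_pos _).le)]
  exact ENNReal.inv_mul_cancel (by simpa using h) ENNReal.ofReal_ne_top

theorem integrable_posterior {f : EuclideanSpace ℝ (Fin p) → ℝ} (hf : Continuous f)
    (hi : Integrable fun y => Real.exp (f y)) {E : Type*} [NormedAddCommGroup E] [NormedSpace ℝ E]
    {g : EuclideanSpace ℝ (Fin p) → E} (hg : Integrable fun y => Real.exp (f y) • g y) :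
    Integrable g (posterior f) := by
  rw [posterior_eq hi]
  refine Integrable.smul_measure ?_ ENNReal.ofReal_ne_top
  rw [integrable_withDensity_iff_integrable_smul' (by fun_prop)
    (.of_forall fun _ => ENNReal.ofReal_lt_top)]
  simpa only [ENNReal.toReal_ofReal (Real.exp_pos _).le] using hg

theorem integral_posterior {f : EuclideanSpace ℝ (Fin p) → ℝ} (hf : Continuous f)
    (hi : Integrable fun y => Real.exp (f y)) (g : EuclideanSpace ℝ (Fin p) → ℝ) :
    (∫ y, g y ∂posterior f) * ∫ y, Real.exp (f y) = ∫ y, Real.exp (f y) * g y := by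
  have h := integral_exp_pos hi
  rw [posterior_eq hi, integral_smul_measure, integral_withDensity_eq_integral_toReal_smul
    (by fun_prop) (.of_forall fun _ => ENNReal.ofReal_lt_top),
    ENNReal.toReal_ofReal (inv_nonneg.2 h.le)]
  simp only [ENNReal.toReal_ofReal (Real.exp_pos _).le, smul_eq_mul]
  field_simp

/-- First moments of the posterior, read off in an affine chart. -/
theorem posterior_of_affineChart {f : EuclideanSpace ℝ (Fin p) → ℝ} (hf : Continuous f)
    {A : Matrix (Fin p) (Fin p) ℝ} (hA : A.det ≠ 0) {xs : EuclideanSpace ℝ (Fin p)} {a : ℝ}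
    (hi : Integrable fun ξ => Real.exp (f (affineChart A xs ξ) - a))
    (hz : ∀ z : Fin p → ℝ,
      Integrable fun ξ => (∑ i, z i * ξ i) * Real.exp (f (affineChart A xs ξ) - a)) :
    IsProbabilityMeasure (posterior f) ∧ Integrable (fun y => y) (posterior f) ∧
      ∀ L : EuclideanSpace ℝ (Fin p) →L[ℝ] ℝ,
        L (posteriorMean f - xs) * ∫ ξ, Real.exp (f (affineChart A xs ξ) - a) =
          ∫ ξ, L (toLp 2 (A *ᵥ ξ)) * Real.exp (f (affineChart A xs ξ) - a) := by
  have hexp : ∀ ξ, Real.exp (f (affineChart A xs ξ)) =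
      Real.exp a * Real.exp (f (affineChart A xs ξ) - a) := fun ξ => by
    rw [← Real.exp_add]
    congr 1
    ring
  have hie : Integrable fun y => Real.exp (f y) := by
    refine integrable_comp_affineChart hA xs (by fun_prop) ?_
    simp_rw [hexp]
    exact hi.const_mul _
  have hid : Integrable fun y => Real.exp (f y) • y := by
    refine integrable_comp_affineChart hA xs (by fun_prop) ?_
    refine Integrable.of_eval_piLp fun i => ?_
    refine (((hi.const_mul (xs i)).add (hz (A i))).const_mul (Real.exp a)).congr
      (.of_forall fun ξ => ?_)
    simp only [Pi.add_apply, PiLp.smul_apply, smul_eq_mul, affineChart, PiLp.add_apply,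
      Matrix.mulVec, dotProduct]
    rw [← affineChart, hexp]
    ring
  have := isProbabilityMeasure_posterior hie
  have hidp := integrable_posterior hf hie hid
  refine ⟨this, hidp, fun L => ?_⟩
  have hL : L (posteriorMean f - xs) = ∫ y, L (y - xs) ∂posterior f := by
    simp_rw [map_sub]
    rw [integral_sub (L.integrable_comp hidp) (integrable_const _), posteriorMean,
      L.integral_comp_comm hidp, integral_const]
    simp
  have h2 := integral_posterior hf hie fun y => L (y - xs)
  rw [← hL] at h2
  -- The Jacobian turns both integrals into integrals over the chart; the common factor `e^a` then
  -- cancels.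
  have h3 := congrArg (fun t => |A.det⁻¹| * t) h2
  beta_reduce at h3
  rw [mul_left_comm, ← integral_comp_affineChart hA xs (by fun_prop),
    ← integral_comp_affineChart hA xs (by fun_prop)] at h3
  simp_rw [hexp, mul_assoc] at h3
  rw [integral_const_mul, integral_const_mul, mul_left_comm] at h3
  have h4 := mul_left_cancel₀ (Real.exp_pos a).ne' h3
  rw [h4]
  refine integral_congr_ae (.of_forall fun ξ => ?_)
  simp only [affineChart, add_sub_cancel_left]
  ring

end Posterior

/-! ### From scalar functionals to `‖Q(x̄ - x*)‖`. -/

section LaplaceMean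

open WithLp

variable {p : ℕ}

theorem dotProduct_mulVec_comp_mulVec (A M : Matrix (Fin p) (Fin p) ℝ) (ξ : Fin p → ℝ) :
    (A *ᵥ ξ) ⬝ᵥ M *ᵥ (A *ᵥ ξ) = ξ ⬝ᵥ (Aᵀ * M * A) *ᵥ ξ := by
  rw [mul_assoc, ← Matrix.mulVec_mulVec ξ Aᵀ (M * A), Matrix.dotProduct_mulVec ξ,
    Matrix.vecMul_transpose, Matrix.mulVec_mulVec]

theorem dotProduct_diagonal_mulVec (l ξ : Fin p → ℝ) :
    ξ ⬝ᵥ Matrix.diagonal l *ᵥ ξ = weightedSq l ξ := by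
  simp only [dotProduct, Matrix.mulVec_diagonal, weightedSq]
  exact Finset.sum_congr rfl fun i _ => by ring

theorem dotProduct_one_mulVec (ξ : Fin p → ℝ) :
    ξ ⬝ᵥ (1 : Matrix (Fin p) (Fin p) ℝ) *ᵥ ξ = ∑ i, ξ i ^ 2 := by
  rw [Matrix.one_mulVec, dotProduct]
  exact Finset.sum_congr rfl fun i _ => by ring

/-- The error bound for a linear functional of the posterior mean, in coordinates in which
`D_G²` is the identity and `D²` is diagonal. -/
theorem abs_posteriorMean_sub_le {f : EuclideanSpace ℝ (Fin p) → ℝ}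
    {G : Matrix (Fin p) (Fin p) ℝ} {xs : EuclideanSpace ℝ (Fin p)} {ν x n c₃ ω : ℝ}
    (hν0 : 0 < ν) (hν : ν ≤ 3 / 4) (hx : 0 < x) (hn : 0 < n) (hc₃ : 0 ≤ c₃) (hf : ContDiff ℝ 3 f)
    (hmax : ∀ y, f y ≤ f xs) (hK : (negHessian f xs - Gᵀ * G).PosSemidef)
    (hconc : ConcaveOn ℝ Set.univ (unpenalized f G xs)) (hsc : SelfConcordant f G xs ν x n c₃)
    (hr : c₃ * radius f G xs x * n ^ (-(1 / 2) : ℝ) ≤ 3 / 4)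
    (hδ : ∀ u ∈ localSet f G xs ν x,
      |taylorRemainder f xs u| ≤ ω * ‖Matrix.toEuclideanLin (matD f G xs) u‖ ^ 2 / 2)
    (hω : ω * effDim f G xs ≤ 2 / 3) {A : Matrix (Fin p) (Fin p) ℝ} {l : Fin p → ℝ}
    (hA1 : Aᵀ * negHessian f xs * A = 1)
    (hA2 : Aᵀ * (negHessian f xs - Gᵀ * G) * A = Matrix.diagonal l) (h0 : ∀ i, 0 ≤ l i)
    (h1 : ∀ i, l i ≤ 1) (hP : effDim f G xs = ∑ i, l i) :
    IsProbabilityMeasure (posterior f) ∧ Integrable (fun y => y) (posterior f) ∧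
      ∀ (L : EuclideanSpace ℝ (Fin p) →L[ℝ] ℝ) (z : Fin p → ℝ),
        (∀ ξ, L (toLp 2 (A *ᵥ ξ)) = ∑ i, z i * ξ i) →
        |L (posteriorMean f - xs)| ≤
          (2.4 * c₃ * (effDim f G xs + 1) ^ (3 / 2 : ℝ) * n ^ (-(1 / 2) : ℝ) +
            laplaceTailConst * Real.exp (-x)) * √(∑ i, z i ^ 2) := by
  have hdet : A.det ≠ 0 := fun h => by
    have h2 := congrArg Matrix.det hA1
    rw [Matrix.det_mul, h, mul_zero, Matrix.det_one] at h2
    exact zero_ne_one h2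
  have hHq : ∀ ξ, (A *ᵥ ξ) ⬝ᵥ negHessian f xs *ᵥ (A *ᵥ ξ) = ∑ i, ξ i ^ 2 := fun ξ => by
    rw [dotProduct_mulVec_comp_mulVec, hA1, dotProduct_one_mulVec]
  have hDq : ∀ ξ, ‖Matrix.toEuclideanLin (matD f G xs) (toLp 2 (A *ᵥ ξ))‖ ^ 2 =
      weightedSq l ξ := fun ξ => by
    rw [norm_toEuclideanLin_matD_sq hK, dotProduct_mulVec_comp_mulVec, hA2,
      dotProduct_diagonal_mulVec]
  have hDn : ∀ ξ, ‖Matrix.toEuclideanLin (matD f G xs) (toLp 2 (A *ᵥ ξ))‖ =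
      √(weightedSq l ξ) := fun ξ => by
    rw [← hDq, Real.sqrt_sq (norm_nonneg _)]
  have hGq : ∀ ξ, ‖Matrix.toEuclideanLin G (toLp 2 (A *ᵥ ξ))‖ ^ 2 =
      ∑ i, ξ i ^ 2 - weightedSq l ξ := fun ξ => by
    rw [← hDq, norm_toEuclideanLin_matD_sq hK, norm_toEuclideanLin_sq, Matrix.sub_mulVec,
      dotProduct_sub, hHq]
    ring
  have hrad : radius f G xs x = 2 * √(∑ i, l i) + √(2 * x) := by rw [radius, hP]
  have hr0 : 0 ≤ radius f G xs x := by
    rw [radius]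
    positivity
  have hloc : ∀ ξ, weightedSq l ξ ≤ (4 / 3 * (2 * √(∑ i, l i) + √(2 * x))) ^ 2 →
      toLp 2 (A *ᵥ ξ) ∈ localSet f G xs ν x := fun ξ hξ => by
    rw [← hrad] at hξ
    change ‖Matrix.toEuclideanLin (matD f G xs) (toLp 2 (A *ᵥ ξ))‖ ≤ ν⁻¹ * radius f G xs x
    rw [hDn]
    refine (Real.sqrt_le_iff.2 ⟨by positivity, hξ⟩).trans ?_
    refine mul_le_mul_of_nonneg_right ?_ hr0
    rw [le_inv_comm₀ (by norm_num) hν0]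
    linarith
  set τ := c₃ * n ^ (-(1 / 2) : ℝ) with hτd
  have hτ0 : 0 ≤ τ := mul_nonneg hc₃ (Real.rpow_nonneg hn.le _)
  have hτ : τ * (2 * √(∑ i, l i) + √(2 * x)) ≤ 3 / 4 := by
    rw [← hrad]
    calc _ = c₃ * radius f G xs x * n ^ (-(1 / 2) : ℝ) := by ring
      _ ≤ _ := hr
  have hfd : fderiv ℝ f xs = 0 := IsLocalMax.fderiv_eq_zero (.of_forall hmax)
  have hexpand : ∀ ξ, f (affineChart A xs ξ) - f xs + (∑ i, ξ i ^ 2) / 2 =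
      f (xs + toLp 2 (A *ᵥ ξ)) - f xs +
        (ofLp (toLp 2 (A *ᵥ ξ)) ⬝ᵥ negHessian f xs *ᵥ ofLp (toLp 2 (A *ᵥ ξ))) / 2 := fun ξ => by
    rw [← hHq, affineChart]
  obtain ⟨hi, hpos, hz⟩ := diagonal_laplace_mean h0 h1 hx hτ0 hτ (w := ω) (hP ▸ hω)
    (F := fun ξ => f (affineChart A xs ξ) - f xs)
    ((hf.continuous.comp (continuous_affineChart A xs)).sub continuous_const).measurable
    (fun ξ hξ => by
      have h := abs_taylor_le_of_selfConcordant hf hn hmax hK hsc (hloc ξ hξ)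
      rwa [← hexpand, hDn] at h)
    (fun ξ hξ => by
      have h := hδ _ (hloc ξ hξ)
      rw [taylorRemainder, hfd, iteratedFDeriv_two_eq_neg_negHessian, hDq] at h
      refine le_of_eq_of_le ?_ h
      rw [hexpand]
      congr 1
      simp only [zero_apply]
      ring)
    (by
      -- In the chart `‖G A ξ‖² = |ξ|² - S`, so the required function is `ℓ` composed with an affine
      -- map, up to a constant.
      have h := (hconc.comp_affineMap
        ((((EuclideanSpace.equiv (Fin p) ℝ).symm.toLinearEquiv.toLinearMap ∘ₗ
          Matrix.toLin' A).toAffineMap +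
          AffineMap.const ℝ (Fin p → ℝ) xs))).add_const (-f xs)
      convert! h using 2 with ξ
      have e : (((EuclideanSpace.equiv (Fin p) ℝ).symm.toLinearEquiv.toLinearMap ∘ₗ
          Matrix.toLin' A).toAffineMap + AffineMap.const ℝ (Fin p → ℝ) xs) ξ =
          affineChart A xs ξ := by
        simp [affineChart, add_comm]
      rw [Pi.add_apply, Function.comp_apply, e, unpenalized, affineChart, add_sub_cancel_left, hGq]
      ring)
  obtain ⟨hprob, hid, hL⟩ := posterior_of_affineChart hf.continuous hdet hi fun z => (hz z).1
  refine ⟨hprob, hid, fun L z hLz => ?_⟩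
  have e1 := hL L
  simp_rw [hLz] at e1
  have e2 := (hz z).2
  rw [← e1, abs_mul, abs_of_pos hpos] at e2
  refine (le_of_mul_le_mul_right e2 hpos).trans_eq ?_
  have hP0 : 0 ≤ ∑ i, l i + 1 := by
    have := Finset.sum_nonneg fun i (_ : i ∈ Finset.univ) => h0 i
    linarith
  have hpow : √(∑ i, l i + 1) ^ 3 = (effDim f G xs + 1) ^ (3 / 2 : ℝ) := by
    rw [hP, Real.sqrt_eq_rpow, ← Real.rpow_natCast, ← Real.rpow_mul hP0]
    norm_num
  rw [hpow, hτd]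
  ring

/-- Test with `L = ⟨v, Q ·⟩` for `v = Q m` itself. Its coordinates are `z = Aᵀ Qᵀ v`, so `|z|² = ⟨v,
Q H⁻¹ Qᵀ v⟩`, and one factor `‖v‖` cancels. -/
theorem norm_toEuclideanLin_posteriorMean_sub_le {q : ℕ} {A H : Matrix (Fin p) (Fin p) ℝ}
    (hA : A * Aᵀ = H⁻¹) (Q : Matrix (Fin q) (Fin p) ℝ) (m : EuclideanSpace ℝ (Fin p)) {b : ℝ}
    (hb : 0 ≤ b)
    (hm : ∀ (L : EuclideanSpace ℝ (Fin p) →L[ℝ] ℝ) (z : Fin p → ℝ),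
      (∀ ξ, L (toLp 2 (A *ᵥ ξ)) = ∑ i, z i * ξ i) → |L m| ≤ b * √(∑ i, z i ^ 2)) :
    ‖Matrix.toEuclideanLin Q m‖ ≤
      b * ‖Matrix.toEuclideanCLM (𝕜 := ℝ) (Q * H⁻¹ * Qᵀ)‖ ^ (1 / 2 : ℝ) := by
  set v := Matrix.toEuclideanLin Q m with hv
  set W := Matrix.toEuclideanCLM (𝕜 := ℝ) (Q * H⁻¹ * Qᵀ) with hW
  set L : EuclideanSpace ℝ (Fin p) →L[ℝ] ℝ :=
    (innerSL ℝ v).comp (Matrix.toEuclideanLin Q).toContinuousLinearMap with hL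
  have hLm : L m = ‖v‖ ^ 2 := by
    rw [← real_inner_self_eq_norm_sq]
    rfl
  set z : Fin p → ℝ := Aᵀ *ᵥ (Qᵀ *ᵥ ofLp v) with hz
  have hLz : ∀ ξ, L (toLp 2 (A *ᵥ ξ)) = ∑ i, z i * ξ i := fun ξ => by
    have e : L (toLp 2 (A *ᵥ ξ)) = ofLp v ⬝ᵥ (Q *ᵥ (A *ᵥ ξ)) := by
      rw [dotProduct_comm]
      rfl
    rw [e, Matrix.dotProduct_mulVec, Matrix.dotProduct_mulVec, hz, Matrix.mulVec_transpose,
      Matrix.mulVec_transpose, dotProduct]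
  have hzz : ∑ i, z i ^ 2 ≤ ‖v‖ ^ 2 * ‖W‖ := by
    have e : ∑ i, z i ^ 2 = inner ℝ v (W v) := by
      rw [hW, Matrix.inner_toEuclideanCLM, ← hA]
      have e2 : ∑ i, z i ^ 2 = z ⬝ᵥ z := by
        rw [dotProduct]
        exact Finset.sum_congr rfl fun i _ => sq _
      rw [e2, hz]
      conv_lhs =>
        rw [Matrix.dotProduct_mulVec, Matrix.vecMul_transpose, Matrix.dotProduct_mulVec,
          Matrix.vecMul_transpose, dotProduct_comm]
      simp only [Matrix.mulVec_mulVec, Matrix.mul_assoc]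
    rw [e]
    calc _ ≤ ‖v‖ * ‖W v‖ := real_inner_le_norm _ _
      _ ≤ ‖v‖ * (‖W‖ * ‖v‖) := by
          gcongr
          exact W.le_opNorm v
      _ = _ := by ring
  have h := hm L z hLz
  rw [hLm, abs_of_nonneg (sq_nonneg _)] at h
  have h2 : √(∑ i, z i ^ 2) ≤ ‖v‖ * √‖W‖ := by
    refine (Real.sqrt_le_sqrt hzz).trans_eq ?_
    rw [Real.sqrt_mul (sq_nonneg _), Real.sqrt_sq (norm_nonneg _)]
  rw [← Real.sqrt_eq_rpow]
  rcases (norm_nonneg v).eq_or_lt with h0 | h0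
  · rw [← h0]
    positivity
  · refine le_of_mul_le_mul_right ?_ h0
    calc ‖v‖ * ‖v‖ = ‖v‖ ^ 2 := (sq _).symm
      _ ≤ _ := h
      _ ≤ b * (‖v‖ * √‖W‖) := by gcongr
      _ = _ := by ring

/-- The matrix `D D_G⁻² D` is `N Nᵀ` with `N = D A`, while `Nᵀ N = diag l ≤ 1`. -/
theorem projVar_matD_le_one {f : EuclideanSpace ℝ (Fin p) → ℝ} {G : Matrix (Fin p) (Fin p) ℝ}
    {xs : EuclideanSpace ℝ (Fin p)} (hK : (negHessian f xs - Gᵀ * G).PosSemidef)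
    {A : Matrix (Fin p) (Fin p) ℝ} {l : Fin p → ℝ}
    (hA2 : Aᵀ * (negHessian f xs - Gᵀ * G) * A = Matrix.diagonal l)
    (hA3 : A * Aᵀ = (negHessian f xs)⁻¹) (h1 : ∀ i, l i ≤ 1) :
    projVar f xs (matD f G xs) ≤ 1 := by
  set N := Matrix.toEuclideanCLM (𝕜 := ℝ) (matD f G xs * A) with hN
  have hN1 : ‖N‖ ≤ 1 := by
    refine N.opNorm_le_bound zero_le_one fun y => ?_
    rw [one_mul]
    refine le_of_sq_le_sq ?_ (norm_nonneg _)
    have e : N y = Matrix.toEuclideanLin (matD f G xs) (toLp 2 (A *ᵥ ofLp y)) := by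
      rw [hN, map_mul]
      rfl
    rw [e, norm_toEuclideanLin_matD_sq hK, dotProduct_mulVec_comp_mulVec, hA2,
      dotProduct_diagonal_mulVec, EuclideanSpace.real_norm_sq_eq]
    exact Finset.sum_le_sum fun i _ => mul_le_of_le_one_left (sq_nonneg _) (h1 i)
  have e : Matrix.toEuclideanCLM (𝕜 := ℝ) (matD f G xs * (negHessian f xs)⁻¹ * (matD f G xs)ᵀ) =
      N * star N := by
    rw [hN, ← map_star, ← map_mul, ← hA3, Matrix.star_eq_conjTranspose,
      Matrix.conjTranspose_eq_transpose_of_trivial, Matrix.transpose_mul]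
    simp only [mul_assoc]
  rw [projVar, e]
  calc ‖N * star N‖ ≤ ‖N‖ * ‖star N‖ := norm_mul_le _ _
    _ = ‖N‖ * ‖N‖ := by
        rw [ContinuousLinearMap.star_eq_adjoint]
        exact congrArg _ (LinearIsometryEquiv.norm_map ContinuousLinearMap.adjoint N)
    _ ≤ 1 * 1 := by gcongr
    _ = 1 := one_mul 1

end LaplaceMean

/-! ### Assembly of the main theorem. -/

theorem mainTheorem5 :
    ∃ C : ℝ, 0 < C ∧
      ∀ (p : ℕ) (f : EuclideanSpace ℝ (Fin p) → ℝ) (G : Matrix (Fin p) (Fin p) ℝ)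
        (xs : EuclideanSpace ℝ (Fin p)) (ν x n c₃ ω : ℝ),
        0 < ν → ν ≤ 3 / 4 → 0 < x → 0 < n → 0 ≤ c₃ →
        ContDiff ℝ 3 f →
        (∀ y, f y ≤ f xs) →
        (negHessian f xs).PosDef →
        ConcaveOn ℝ Set.univ (unpenalized f G xs) →
        SelfConcordant f G xs ν x n c₃ →
        c₃ * radius f G xs x * n ^ (-(1 / 2) : ℝ) ≤ 3 / 4 →
        (∀ u ∈ localSet f G xs ν x,
          |taylorRemainder f xs u| ≤ ω * ‖Matrix.toEuclideanLin (matD f G xs) u‖ ^ 2 / 2) →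
        ω * effDim f G xs ≤ 2 / 3 →
        IsProbabilityMeasure (posterior f) ∧
        Integrable (fun y => y) (posterior f) ∧
        (∀ (q : ℕ) (Q : Matrix (Fin q) (Fin p) ℝ),
          ‖Matrix.toEuclideanLin Q (posteriorMean f - xs)‖ ≤
            2.4 * c₃ * (effDim f G xs + 1) ^ (3 / 2 : ℝ) * n ^ (-(1 / 2) : ℝ) *
                (projVar f xs Q) ^ (1 / 2 : ℝ) +
              C * (projVar f xs Q) ^ (1 / 2 : ℝ) * Real.exp (-x)) ∧
        ‖Matrix.toEuclideanLin (matD f G xs) (posteriorMean f - xs)‖ ≤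
          2.4 * c₃ * (effDim f G xs + 1) ^ (3 / 2 : ℝ) * n ^ (-(1 / 2) : ℝ) *
              (projVar f xs (matD f G xs)) ^ (1 / 2 : ℝ) + C * Real.exp (-x) ∧
        ‖Matrix.toEuclideanLin (matD f G xs) (posteriorMean f - xs)‖ ≤
          2.4 * c₃ * (effDim f G xs + 1) ^ (3 / 2 : ℝ) * n ^ (-(1 / 2) : ℝ) +
            C * Real.exp (-x) := by
  refine ⟨laplaceTailConst, by unfold laplaceTailConst; positivity, ?_⟩
  intro p f G xs ν x n c₃ ω hν0 hν hx hn hc₃ hf hmax hH hconc hsc hr hδ hω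
  have hC : 0 < laplaceTailConst := by unfold laplaceTailConst; positivity
  have hK := posSemidef_negHessian_sub hf hH.isHermitian hconc
  obtain ⟨A, l, hA1, hA2, hA3⟩ := exists_simultaneous_diagonalization hH hK.isHermitian
  have h0 : ∀ i, 0 ≤ l i := by
    have h := hK.conjTranspose_mul_mul_same A
    rw [Matrix.conjTranspose_eq_transpose_of_trivial, hA2] at h
    exact Matrix.posSemidef_diagonal_iff.1 h
  -- `1 - diag l` is the Gram matrix of `G A`, since `D_G² - D² = GᵀG`.
  have h1 : ∀ i, l i ≤ 1 := by
    have h := Matrix.posSemidef_conjTranspose_mul_self (G * A)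
    have e : (G * A)ᵀ * (G * A) = Matrix.diagonal fun i => 1 - l i := by
      rw [← Matrix.diagonal_sub, ← hA2, Matrix.diagonal_one, ← hA1, Matrix.transpose_mul]
      noncomm_ring
    rw [Matrix.conjTranspose_eq_transpose_of_trivial, e] at h
    exact fun i => sub_nonneg.1 (Matrix.posSemidef_diagonal_iff.1 h i)
  have hP : effDim f G xs = ∑ i, l i := by
    rw [effDim, ← hA3, ← mul_assoc, Matrix.trace_mul_comm, ← mul_assoc, hA2, Matrix.trace_diagonal]
  have hP0 : 0 ≤ effDim f G xs + 1 := by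
    have := Finset.sum_nonneg fun i (_ : i ∈ Finset.univ) => h0 i
    rw [hP]
    linarith
  obtain ⟨hprob, hid, hb⟩ := abs_posteriorMean_sub_le hν0 hν hx hn hc₃ hf hmax hK hconc hsc hr hδ
    hω hA1 hA2 h0 h1 hP
  set b := 2.4 * c₃ * (effDim f G xs + 1) ^ (3 / 2 : ℝ) * n ^ (-(1 / 2) : ℝ) with hbd
  have hb0 : 0 ≤ b := by positivity
  have hQ : ∀ (q : ℕ) (Q : Matrix (Fin q) (Fin p) ℝ),
      ‖Matrix.toEuclideanLin Q (posteriorMean f - xs)‖ ≤ b * (projVar f xs Q) ^ (1 / 2 : ℝ) +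
        laplaceTailConst * (projVar f xs Q) ^ (1 / 2 : ℝ) * Real.exp (-x) := fun q Q => by
    refine (norm_toEuclideanLin_posteriorMean_sub_le hA3 Q _ (by positivity) hb).trans_eq ?_
    rw [projVar]
    ring
  have hv1 : (projVar f xs (matD f G xs)) ^ (1 / 2 : ℝ) ≤ 1 :=
    Real.rpow_le_one (norm_nonneg _) (projVar_matD_le_one hK hA2 hA3 h1) (by norm_num)
  have hD := hQ p (matD f G xs)
  have hD2 : ‖Matrix.toEuclideanLin (matD f G xs) (posteriorMean f - xs)‖ ≤
      b * (projVar f xs (matD f G xs)) ^ (1 / 2 : ℝ) + laplaceTailConst * Real.exp (-x) := by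
    refine hD.trans ?_
    gcongr
    exact mul_le_of_le_one_right hC.le hv1
  refine ⟨hprob, hid, hQ, hD2, hD2.trans ?_⟩
  gcongr
  exact mul_le_of_le_one_right hb0 hv1
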